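/- Let $n\ge 2$ and consider the reinforcement model (WARM) with weight function $W(x)=x^{\alpha}$, $\alpha>1$, on the star graph with $n$ edges: a vertex is chosen uniformly from the $n+1$ vertices, and then one of the edges incident to it is reinforced, edge $i$ having weight $v_i^\alpha$. Thus, for $v$ in the simplex $\Delta_n=\{v\in\mathbb{R}^n: v_i\ge 0,\ \sum_i v_i=1\}$, put $$F(v)_i=-v_i+\sum_{A\ni i}p_A\,\frac{v_i^{\alpha}}{\sum_{j\in A}v_j^{\alpha}},$$ where $p_A$ is the probability that $A$ is the set of edges incident to the chosen vertex (so $p_{\{i\}}=p_{\{1,\dots,n\}}=1/(n+1)$ and all other $p_A$ are $0$). An equilibrium is a $v\in\Delta_n$ with $F(v)=0$. It is linearly stable if all eigenvalues of the matrix $(\partial F(v)_i/\partial v_k)_{i,k}$ have negative real part, linearly unstable if some eigenvalue has positive real part, and critical otherwise. Write $(a)_k=(a,\dots,a)\in\mathbb{R}^k$; vectors are understood up to permutation of the coordinates. There exist $\tilde\alpha(k,n)\in(1,n+1)$, $k\in\{1,\dots,n\}$, such that the equilibria for $\alpha>1$ are exactly the following (with $v=v(\alpha)>u=u(\alpha)$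 depending on $k$, $n$ and the family, and exactly one pair $(v,u)$ for each $k$ and $\alpha$ in each of (ii)--(iv)): (i) $(1/n)_n$, for all $\alpha>1$; (ii) $((v)_k,(u)_{n-k})$ for $1\le k<n/2$ and $\alpha\ge\tilde\alpha(k,n)$, with $v(\alpha)$ strictly increasing in $\alpha$; (iii) $((v)_k,(u)_{n-k})$ for $1\le k<n/2$ and $\alpha\in(\tilde\alpha(k,n),n+1)$, with $v(\alpha)$ strictly decreasing in $\alpha$ and smaller than the $v(\alpha)$ of (ii); (iv) $((v)_k,(u)_{n-k})$ for $n/2\le k\le n-1$ and $\alpha>n+1$, with $v(\alpha)$ strictly increasing in $\alpha$. Moreover, $(1/n)_n$ is linearly stable if and only if $\alpha<n+1$, and it is critical when $\alpha=n+1$. Equilibrium (ii) is linearly stable if and only if $k=1$ and $\alpha>\tilde\alpha(1,n)$. For $n=2$ (when (ii) and (iii) are empty), equilibrium (iv), with $k=1$ and $\alpha>3$, is linearly stable. In both of these stable cases, $v(\alpha)\to 2/(n+1)$ as $\alpha\to\infty$. All other equilibria, that is, (iii) for every $k$ and (iv) for $n\ge 3$, are not linearly stable. -/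

import Mathlib

open Filter Topology

noncomputable section

/-- The vector field of the reinforcement model with weight function `W x = x ^ α`, whose random
subset of colours has law `p` (so `p A` is the probability that the subset is `A`):
`F(v)_i = -v_i + ∑_{A ∋ i} p_A v_i^α / ∑_{j ∈ A} v_j^α`. It is the limit defining the field for
general `W`, see `tendsto_warmField`.

Where all `v_j`, `j ∈ A`, vanish, the quotient is `0 / 0 = 0` in Lean. This creates no zeros of `F`
on the simplex: there the coordinates of `F(v)` add up to `-1` plus the total probability of those
sets `A` on which `v` does not vanish identically, so that `F(v) = 0` forces `v` not to vanish
identically on any `A` of positive probability. -/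
def warmField {E : Type*} [Fintype E] [DecidableEq E] (p : Finset E → ℝ) (α : ℝ)
    (v : E → ℝ) (i : E) : ℝ :=
  -v i + ∑ A : Finset E with i ∈ A, p A * (v i ^ α / ∑ j ∈ A, v j ^ α)

/-- For `W x = x ^ α`, the proportion of the weights does not depend on the scale `t`, and the
field is the limit of `-v_i + ∑_{A ∋ i} p_A W(v_i t) / ∑_{j ∈ A} W(v_j t)` as `t → ∞`. -/
theorem tendsto_warmField {E : Type*} [Fintype E] [DecidableEq E] (p : Finset E → ℝ) (α : ℝ)
    (v : E → ℝ) (hv : ∀ i, 0 ≤ v i) (i : E) :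
    Tendsto (fun t : ℝ => -v i + ∑ A : Finset E with i ∈ A,
      p A * ((v i * t) ^ α / ∑ j ∈ A, (v j * t) ^ α)) atTop (𝓝 (warmField p α v i)) := by
  refine tendsto_const_nhds.congr' ?_
  filter_upwards [eventually_gt_atTop (0 : ℝ)] with t ht
  have hpos : t ^ α ≠ 0 := (Real.rpow_pos_of_pos ht α).ne'
  simp only [warmField, Real.mul_rpow (hv _) ht.le, ← Finset.sum_mul, mul_div_mul_right _ _ hpos]

/-- An equilibrium: a point of the probability simplex at which the field vanishes. -/
def IsEquilibrium {E : Type*} [Fintype E] [DecidableEq E] (p : Finset E → ℝ) (α : ℝ)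
    (v : E → ℝ) : Prop :=
  (∀ i, 0 ≤ v i) ∧ ∑ i, v i = 1 ∧ ∀ i, warmField p α v i = 0

/-- `D` is the matrix of the partial derivatives `D_{i,k} = ∂F(v)_i / ∂v_k` of the field at `v`
(all of which exist). -/
def IsPartialsMatrix {E : Type*} [Fintype E] [DecidableEq E] (p : Finset E → ℝ) (α : ℝ)
    (v : E → ℝ) (D : Matrix E E ℝ) : Prop :=
  ∀ i k, HasDerivAt (fun s : ℝ => warmField p α (Function.update v k s) i) (D i k) (v k)

/-- `μ` is a complex eigenvalue of the real matrix `D`. -/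
def IsComplexEigenvalue {E : Type*} [Fintype E] [DecidableEq E] (D : Matrix E E ℝ) (μ : ℂ) :
    Prop :=
  Module.End.HasEigenvalue (Matrix.toLin' (D.map Complex.ofReal)) μ

/-- A linearly stable equilibrium: all eigenvalues of the matrix of partial derivatives have
negative real part. -/
def IsLinearlyStable {E : Type*} [Fintype E] [DecidableEq E] (p : Finset E → ℝ) (α : ℝ)
    (v : E → ℝ) : Prop :=
  IsEquilibrium p α v ∧ ∃ D : Matrix E E ℝ, IsPartialsMatrix p α v D ∧
    ∀ μ : ℂ, IsComplexEigenvalue D μ → μ.re < 0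

/-- A linearly unstable equilibrium: some eigenvalue has positive real part. -/
def IsLinearlyUnstable {E : Type*} [Fintype E] [DecidableEq E] (p : Finset E → ℝ) (α : ℝ)
    (v : E → ℝ) : Prop :=
  IsEquilibrium p α v ∧ ∃ D : Matrix E E ℝ, IsPartialsMatrix p α v D ∧
    ∃ μ : ℂ, IsComplexEigenvalue D μ ∧ 0 < μ.re

/-- A critical equilibrium: neither linearly stable nor linearly unstable (and the partial
derivatives exist). -/
def IsCritical {E : Type*} [Fintype E] [DecidableEq E] (p : Finset E → ℝ) (α : ℝ)
    (v : E → ℝ) : Prop :=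
  IsEquilibrium p α v ∧ (∃ D : Matrix E E ℝ, IsPartialsMatrix p α v D) ∧
    ¬ IsLinearlyStable p α v ∧ ¬ IsLinearlyUnstable p α v

/-- The law of the random subset for a graph, whose colours are its edges: `graphLaw G A` is the
probability that a uniformly chosen vertex has `A` as its set of incident edges. -/
def graphLaw {V : Type*} [Fintype V] (G : SimpleGraph V) (A : Finset G.edgeSet) : ℝ :=
  ({x : V | ∀ e : G.edgeSet, e ∈ A ↔ x ∈ (e : Sym2 V)}.ncard : ℝ) / Fintype.card V

/-- The edges of the star graph with `n` edges: its vertices are `0, …, n` and its centre is `0`. -/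
abbrev StarEdge (n : ℕ) : Type := (SimpleGraph.starGraph (0 : Fin (n + 1))).edgeSet

/-- The law of the random subset of edges for the star graph with `n` edges. -/
def starLaw (n : ℕ) : Finset (StarEdge n) → ℝ :=
  graphLaw (SimpleGraph.starGraph (0 : Fin (n + 1)))

/-- Up to the labelling of the coordinates, `x` is the vector `((a)_k, (b)_{n-k})`: `k` of its
coordinates are equal to `a` and all the others are equal to `b`. -/
def IsTwoValued {E : Type*} (k : ℕ) (a b : ℝ) (x : E → ℝ) : Prop :=
  ∃ S : Finset E, S.card = k ∧ (∀ e ∈ S, x e = a) ∧ ∀ e ∉ S, x e = b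

end

/-!
On the star graph with `n` edges, a vector `v` of the simplex is an equilibrium exactly if its
coordinates are positive and the shares `w i = v i ^ α / ∑ j, v j ^ α` satisfy
`(n + 1) * v i - 1 = w i` (`isEquilibrium_iff_weights`). A strictly convex power meets a line in at
most two points, so `v` is constant or takes two values `v > u`. If `v` is taken `k` times and
`m = n - k`, the ratio `r = v / u` determines the vector, `u = 1 / (k * r + m)`, and the equilibrium
condition becomes `α = ratioExponent k m r`, a quotient of logarithms defined for
`1 < r < (k + 1) / k` (`isEquilibrium_iff`).

The list of equilibria is therefore the inversion of `ratioExponent k m`, which tends to `n + 1` at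
`r = 1` and to infinity at `r = (k + 1) / k`. Its derivative has the sign of `exponentSlope k m`,
which vanishes at `1` and whose own derivative has the sign of
`k * (m + 1) * r ^ 2 - m * (k + 1)`. Hence for `m ≤ k` the exponent increases
(`exists_branch_of_le`), while for `k < m` it first decreases to a minimum, the threshold, and then
increases (`exists_branches_of_lt`).

At an equilibrium the matrix of partial derivatives is a function of the shares
(`stabilityMatrix`), and its eigenvectors are explicit. The difference of two edges of equal share
`w` has eigenvalue `-1 + α * w / (1 + w)`; by Bernoulli's inequality, that is, because the power
lies above its tangents, this is positive for the larger share and negative for the smaller one. So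
`k ≥ 2` excludes stability. The vector of sum zero that is constant on both classes has an
eigenvalue of the sign of `-exponentSlope k m r` (`exponentSlope_pos_iff`), and the only further
eigenvalue is `-1`, because the columns of the matrix all add up to `-1`. So for `k = 1` an
equilibrium is stable exactly where the exponent increases with the ratio
(`isLinearlyStable_iff_of_isTwoValued`).
-/

/-! ### The exponent as a function of the ratio of the two values -/

/-- The logarithm of `w(v) / w(u)`, where `w(t) = (n + 1) t - 1`, at the two-valued vector of the
simplex with `k` coordinates `v`, `m = n - k` coordinates `u` and ratio `r = v / u`. -/
noncomputable def logOdds (k m r : ℝ) : ℝ :=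
  Real.log ((m + 1) * r - m) - Real.log (k + 1 - k * r)

/-- The exponent `α` for which the two-valued vector of ratio `r` is an equilibrium, extended
continuously to `r = 1`. -/
noncomputable def ratioExponent (k m r : ℝ) : ℝ :=
  if r = 1 then k + m + 1 else logOdds k m r / Real.log r

/-- The derivative of `ratioExponent k m` at `r > 1`, up to the positive factor
`1 / (r * (log r) ^ 2)`. -/
noncomputable def exponentSlope (k m r : ℝ) : ℝ :=
  r * (k + m + 1) / (((m + 1) * r - m) * (k + 1 - k * r)) * Real.log r - logOdds k m r

lemma lt_ratio_bound_iff {k r : ℝ} (hk : 0 < k) : r < (k + 1) / k ↔ 0 < k + 1 - k * r := by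
  rw [lt_div_iff₀ hk, sub_pos, mul_comm]

lemma one_lt_ratio_bound {k : ℝ} (hk : 0 < k) : 1 < (k + 1) / k := by
  rw [lt_div_iff₀ hk]; linarith

lemma weight_high_pos {m r : ℝ} (hm : 0 < m) (hr : 1 ≤ r) : 0 < (m + 1) * r - m := by
  nlinarith

lemma hasDerivAt_logOdds {k m r : ℝ} (hk : 0 < k) (hm : 0 < m) (h1 : 1 ≤ r)
    (h2 : r < (k + 1) / k) :
    HasDerivAt (logOdds k m) ((k + m + 1) / (((m + 1) * r - m) * (k + 1 - k * r))) r := by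
  have ha := weight_high_pos hm h1
  have hb := (lt_ratio_bound_iff hk).1 h2
  have e1 : HasDerivAt (fun r : ℝ => (m + 1) * r - m) (m + 1) r := by
    simpa using ((hasDerivAt_id r).const_mul (m + 1)).sub_const m
  have e2 : HasDerivAt (fun r : ℝ => k + 1 - k * r) (-k) r := by
    simpa using ((hasDerivAt_id r).const_mul k).const_sub (k + 1)
  refine ((e1.log ha.ne').sub (e2.log hb.ne')).congr_deriv ?_
  rw [div_sub_div _ _ ha.ne' hb.ne']
  congr 1
  ring

lemma logOdds_one (k m : ℝ) : logOdds k m 1 = 0 := by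
  simp [logOdds]

lemma exponentSlope_one (k m : ℝ) : exponentSlope k m 1 = 0 := by
  simp [exponentSlope, logOdds_one]

lemma hasDerivAt_exponentSlope {k m r : ℝ} (hk : 0 < k) (hm : 0 < m) (h1 : 1 ≤ r)
    (h2 : r < (k + 1) / k) :
    HasDerivAt (exponentSlope k m)
      ((k + m + 1) * (k * (m + 1) * r ^ 2 - m * (k + 1)) /
        (((m + 1) * r - m) * (k + 1 - k * r)) ^ 2 * Real.log r) r := by
  have ha := weight_high_pos hm h1
  have hb := (lt_ratio_bound_iff hk).1 h2
  have e1 : HasDerivAt (fun r : ℝ => (m + 1) * r - m) (m + 1) r := by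
    simpa using ((hasDerivAt_id r).const_mul (m + 1)).sub_const m
  have e2 : HasDerivAt (fun r : ℝ => k + 1 - k * r) (-k) r := by
    simpa using ((hasDerivAt_id r).const_mul k).const_sub (k + 1)
  have e3 : HasDerivAt (fun r : ℝ => r * (k + m + 1)) (k + m + 1) r := by
    simpa using (hasDerivAt_id r).mul_const (k + m + 1)
  refine (((e3.div (e1.mul e2) (mul_pos ha hb).ne').mul
    (Real.hasDerivAt_log (by linarith : r ≠ 0))).sub
    (hasDerivAt_logOdds hk hm h1 h2)).congr_deriv ?_
  have hr : r ≠ 0 := by linarith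
  simp only [Pi.mul_apply, Pi.div_apply]
  field_simp
  ring

lemma hasDerivAt_ratioExponent {k m r : ℝ} (hk : 0 < k) (hm : 0 < m) (h1 : 1 < r)
    (h2 : r < (k + 1) / k) :
    HasDerivAt (ratioExponent k m) (exponentSlope k m r / (r * Real.log r ^ 2)) r := by
  have hl := Real.log_pos h1
  have ha := weight_high_pos hm h1.le
  have hb := (lt_ratio_bound_iff hk).1 h2
  have hr : r ≠ 0 := by linarith
  have := (hasDerivAt_logOdds hk hm h1.le h2).div (Real.hasDerivAt_log hr) hl.ne'
  refine (this.congr_deriv ?_).congr_of_eventuallyEq ?_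
  · rw [exponentSlope]
    field_simp
  · filter_upwards [lt_mem_nhds h1] with s hs
    simp [ratioExponent, (show s ≠ 1 from hs.ne')]

lemma continuousAt_ratioExponent {k m r : ℝ} (hk : 0 < k) (hm : 0 < m) (h1 : 1 ≤ r)
    (h2 : r < (k + 1) / k) : ContinuousAt (ratioExponent k m) r := by
  rcases h1.eq_or_lt with rfl | h1
  · have d1 := hasDerivAt_logOdds hk hm le_rfl h2
    have d2 := Real.hasDerivAt_log one_ne_zero
    have c1 := continuousAt_dslope_same.2 d1.differentiableAt
    have c2 := continuousAt_dslope_same.2 d2.differentiableAt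
    have := c1.div c2 (by simp [dslope_same])
    refine this.congr (Eventually.of_forall fun s => ?_)
    by_cases hs : s = 1
    · subst hs
      simp [ratioExponent, dslope_same, d1.deriv]
    · have : s - 1 ≠ 0 := sub_ne_zero.2 hs
      simp only [Pi.div_apply, dslope_of_ne _ hs, slope_def_field, logOdds_one, ratioExponent,
        if_neg hs, Real.log_one, sub_zero]
      field_simp
  · exact (hasDerivAt_ratioExponent hk hm h1 h2).continuousAt

lemma continuousOn_ratioExponent {k m : ℝ} (hk : 0 < k) (hm : 0 < m) :
    ContinuousOn (ratioExponent k m) (Set.Ico 1 ((k + 1) / k)) := fun _ hr =>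
  (continuousAt_ratioExponent hk hm hr.1 hr.2).continuousWithinAt

lemma continuousOn_exponentSlope {k m : ℝ} (hk : 0 < k) (hm : 0 < m) :
    ContinuousOn (exponentSlope k m) (Set.Ico 1 ((k + 1) / k)) := fun _ hr =>
  (hasDerivAt_exponentSlope hk hm hr.1 hr.2).continuousAt.continuousWithinAt

lemma tendsto_ratioExponent {k m : ℝ} (hk : 0 < k) (hm : 0 < m) :
    Tendsto (ratioExponent k m) (𝓝[<] ((k + 1) / k)) atTop := by
  have hR := one_lt_ratio_bound hk
  have hlog := Real.log_pos hR
  have t1 : Tendsto (fun r : ℝ => k + 1 - k * r) (𝓝[<] ((k + 1) / k)) (𝓝[>] 0) := by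
    refine tendsto_nhdsWithin_iff.2 ⟨?_, ?_⟩
    · have : ContinuousAt (fun r : ℝ => k + 1 - k * r) ((k + 1) / k) := by fun_prop
      have h := this.tendsto
      rw [mul_div_cancel₀ _ hk.ne', sub_self] at h
      exact h.mono_left nhdsWithin_le_nhds
    · filter_upwards [self_mem_nhdsWithin] with r hr
      exact (lt_ratio_bound_iff hk).1 hr
  have t2 := Real.tendsto_log_nhdsGT_zero.comp t1
  have t3 : Tendsto (fun r : ℝ => Real.log ((m + 1) * r - m)) (𝓝[<] ((k + 1) / k))
      (𝓝 (Real.log ((m + 1) * ((k + 1) / k) - m))) := by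
    have : ContinuousAt (fun r : ℝ => Real.log ((m + 1) * r - m)) ((k + 1) / k) :=
      ContinuousAt.log (by fun_prop) (weight_high_pos hm hR.le).ne'
    exact this.tendsto.mono_left nhdsWithin_le_nhds
  have t4 : Tendsto (logOdds k m) (𝓝[<] ((k + 1) / k)) atTop := by
    have := t3.add_atTop (tendsto_neg_atBot_atTop.comp t2)
    refine this.congr fun r => ?_
    simp [logOdds, sub_eq_add_neg]
  have t5 : Tendsto (fun r : ℝ => (Real.log r)⁻¹) (𝓝[<] ((k + 1) / k))
      (𝓝 (Real.log ((k + 1) / k))⁻¹) :=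
    ((Real.continuousAt_log (by linarith)).inv₀ hlog.ne').tendsto.mono_left nhdsWithin_le_nhds
  refine (t4.atTop_mul_pos (inv_pos.2 hlog) t5).congr' ?_
  filter_upwards [mem_nhdsWithin_of_mem_nhds (lt_mem_nhds hR)] with r hr
  simp [ratioExponent, (show r ≠ 1 from hr.ne'), div_eq_mul_inv]

/-- The exponent is strictly monotone where its slope is positive. -/
lemma strictMonoOn_ratioExponent {k m r₀ : ℝ} (hk : 0 < k) (hm : 0 < m) (h0 : 1 ≤ r₀)
    (hpos : ∀ r ∈ Set.Ioo r₀ ((k + 1) / k), 0 < exponentSlope k m r) :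
    StrictMonoOn (ratioExponent k m) (Set.Ico r₀ ((k + 1) / k)) := by
  refine strictMonoOn_of_deriv_pos (convex_Ico _ _)
    ((continuousOn_ratioExponent hk hm).mono (Set.Ico_subset_Ico_left h0)) fun r hr => ?_
  rw [interior_Ico] at hr
  have h1 : 1 < r := h0.trans_lt hr.1
  rw [(hasDerivAt_ratioExponent hk hm h1 hr.2).deriv]
  have := Real.log_pos h1
  have := hpos r hr
  positivity

/-- The exponent is strictly antitone where its slope is negative. -/
lemma strictAntiOn_ratioExponent {k m r₀ : ℝ} (hk : 0 < k) (hm : 0 < m) (h0 : r₀ < (k + 1) / k)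
    (hneg : ∀ r ∈ Set.Ioo 1 r₀, exponentSlope k m r < 0) :
    StrictAntiOn (ratioExponent k m) (Set.Icc 1 r₀) := by
  refine strictAntiOn_of_deriv_neg (convex_Icc _ _)
    ((continuousOn_ratioExponent hk hm).mono fun r hr => ⟨hr.1, hr.2.trans_lt h0⟩) fun r hr => ?_
  rw [interior_Icc] at hr
  rw [(hasDerivAt_ratioExponent hk hm hr.1 (hr.2.trans h0)).deriv]
  have := Real.log_pos hr.1
  have : 0 < r := by linarith [hr.1]
  exact div_neg_of_neg_of_pos (hneg r hr) (by positivity)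

/-- For `m ≤ k` the slope increases from `0`. -/
lemma exponentSlope_pos {k m : ℝ} (hk : 0 < k) (hm : 0 < m) (hmk : m ≤ k) :
    ∀ r ∈ Set.Ioo 1 ((k + 1) / k), 0 < exponentSlope k m r := by
  have hmono : StrictMonoOn (exponentSlope k m) (Set.Ico 1 ((k + 1) / k)) := by
    refine strictMonoOn_of_deriv_pos (convex_Ico _ _) (continuousOn_exponentSlope hk hm)
      fun r hr => ?_
    rw [interior_Ico] at hr
    rw [(hasDerivAt_exponentSlope hk hm hr.1.le hr.2).deriv]
    have := Real.log_pos hr.1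
    have := weight_high_pos hm hr.1.le
    have := (lt_ratio_bound_iff hk).1 hr.2
    have hr2 : 1 < r ^ 2 := by nlinarith [hr.1]
    have : 0 < k * (m + 1) * r ^ 2 - m * (k + 1) := by
      nlinarith [mul_pos (mul_pos hk (by linarith : 0 < m + 1)) (sub_pos.2 hr2)]
    positivity
  intro r hr
  rw [← exponentSlope_one k m]
  exact hmono ⟨le_rfl, one_lt_ratio_bound hk⟩ ⟨hr.1.le, hr.2⟩ hr.1

/-- For `k < m` the slope decreases from `0`, then increases, and becomes positive because the
exponent is unbounded; so it changes sign exactly once. -/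
lemma exists_exponentSlope_sign {k m : ℝ} (hk : 0 < k) (hm : 0 < m) (hkm : k < m) :
    ∃ r₀ ∈ Set.Ioo 1 ((k + 1) / k), exponentSlope k m r₀ = 0 ∧
      (∀ r ∈ Set.Ioo 1 r₀, exponentSlope k m r < 0) ∧
      ∀ r ∈ Set.Ioo r₀ ((k + 1) / k), 0 < exponentSlope k m r := by
  set R := (k + 1) / k with hRdef
  have hR : 1 < R := one_lt_ratio_bound hk
  have hkm1 : 0 < k * (m + 1) := by positivity
  -- the point where the derivative of the slope changes sign
  set c := Real.sqrt (m * (k + 1) / (k * (m + 1))) with hc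
  have hc2 : c ^ 2 = m * (k + 1) / (k * (m + 1)) := Real.sq_sqrt (by positivity)
  have hc2' : k * (m + 1) * c ^ 2 = m * (k + 1) := by rw [hc2]; field_simp
  have hc0 : 0 ≤ c := Real.sqrt_nonneg _
  have hc1 : 1 < c := by
    by_contra! h
    have : c ^ 2 ≤ 1 := by nlinarith
    nlinarith
  have hcR : c < R := by
    have h1 : c ^ 2 < R := by
      rw [hc2, hRdef, div_lt_div_iff₀ hkm1 hk]
      nlinarith [mul_pos hk hk]
    nlinarith
  have hanti : StrictAntiOn (exponentSlope k m) (Set.Icc 1 c) := by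
    refine strictAntiOn_of_deriv_neg (convex_Icc _ _)
      ((continuousOn_exponentSlope hk hm).mono fun r hr => ⟨hr.1, hr.2.trans_lt hcR⟩) fun r hr => ?_
    rw [interior_Icc] at hr
    have hrR := hr.2.trans hcR
    rw [(hasDerivAt_exponentSlope hk hm hr.1.le hrR).deriv]
    have hl := Real.log_pos hr.1
    have := weight_high_pos hm hr.1.le
    have := (lt_ratio_bound_iff hk).1 hrR
    have hlt : r ^ 2 < c ^ 2 := by nlinarith [hr.1, hr.2]
    have : k * (m + 1) * r ^ 2 - m * (k + 1) < 0 := by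
      nlinarith [mul_pos hkm1 (sub_pos.2 hlt)]
    refine mul_neg_of_neg_of_pos (div_neg_of_neg_of_pos ?_ (by positivity)) hl
    exact mul_neg_of_pos_of_neg (by positivity) this
  have hmono : StrictMonoOn (exponentSlope k m) (Set.Ico c R) := by
    refine strictMonoOn_of_deriv_pos (convex_Ico _ _)
      ((continuousOn_exponentSlope hk hm).mono (Set.Ico_subset_Ico_left hc1.le)) fun r hr => ?_
    rw [interior_Ico] at hr
    have hr1 := hc1.trans hr.1
    rw [(hasDerivAt_exponentSlope hk hm hr1.le hr.2).deriv]
    have hl := Real.log_pos hr1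
    have := weight_high_pos hm hr1.le
    have := (lt_ratio_bound_iff hk).1 hr.2
    have hlt : c ^ 2 < r ^ 2 := by nlinarith [hr.1]
    have : 0 < k * (m + 1) * r ^ 2 - m * (k + 1) := by
      nlinarith [mul_pos hkm1 (sub_pos.2 hlt)]
    positivity
  have hneg : ∀ r ∈ Set.Ioc 1 c, exponentSlope k m r < 0 := fun r hr => by
    rw [← exponentSlope_one k m]
    exact hanti ⟨le_rfl, hc1.le⟩ ⟨hr.1.le, hr.2⟩ hr.1
  obtain ⟨s, hs, hspos⟩ : ∃ s ∈ Set.Ioo c R, 0 < exponentSlope k m s := by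
    by_contra! hcon
    have hle : AntitoneOn (ratioExponent k m) (Set.Ico c R) := by
      refine antitoneOn_of_deriv_nonpos (convex_Ico _ _)
        ((continuousOn_ratioExponent hk hm).mono (Set.Ico_subset_Ico_left hc1.le)) ?_ ?_
      · rw [interior_Ico]
        exact fun r hr => (hasDerivAt_ratioExponent hk hm (hc1.trans hr.1)
          hr.2).differentiableAt.differentiableWithinAt
      · rw [interior_Ico]
        intro r hr
        rw [(hasDerivAt_ratioExponent hk hm (hc1.trans hr.1) hr.2).deriv]
        have : 0 < r := by linarith [hr.1]
        exact div_nonpos_of_nonpos_of_nonneg (hcon r hr) (by positivity)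
    obtain ⟨r, hr1, hr2⟩ := ((tendsto_ratioExponent hk hm).eventually_gt_atTop
      (ratioExponent k m c) |>.and (Ioo_mem_nhdsLT hcR)).exists
    exact absurd (hle ⟨le_rfl, hcR⟩ ⟨hr2.1.le, hr2.2⟩ hr2.1.le) (not_le.2 hr1)
  obtain ⟨r₀, hr₀, hz⟩ := intermediate_value_Ioo hs.1.le
    ((continuousOn_exponentSlope hk hm).mono fun r hr => ⟨hc1.le.trans hr.1, hr.2.trans_lt hs.2⟩)
    ⟨hneg c ⟨hc1, le_rfl⟩, hspos⟩
  have hr₀R := hr₀.2.trans hs.2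
  refine ⟨r₀, ⟨hc1.trans hr₀.1, hr₀R⟩, hz, fun r hr => ?_, fun r hr => ?_⟩
  · rcases le_or_gt r c with h | h
    · exact hneg r ⟨hr.1, h⟩
    · rw [← hz]
      exact hmono ⟨h.le, hr.2.trans hr₀R⟩ ⟨hr₀.1.le, hr₀R⟩ hr.2
  · rw [← hz]
    exact hmono ⟨hr₀.1.le, hr₀R⟩ ⟨hr₀.1.le.trans hr.1.le, hr.2⟩ hr.1

/-! ### Inverting the exponent -/

/-- A strictly increasing continuous function on `[a, b)` that tends to infinity at `b` has a
strictly increasing inverse on `[f a, ∞)`, which tends to `b`. -/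
lemma StrictMonoOn.exists_inverse_Ici {f : ℝ → ℝ} {a b : ℝ} (hab : a < b)
    (hf : StrictMonoOn f (Set.Ico a b)) (hc : ContinuousOn f (Set.Ico a b))
    (ht : Tendsto f (𝓝[<] b) atTop) :
    ∃ g : ℝ → ℝ, (∀ y, f a ≤ y → g y ∈ Set.Ico a b ∧ f (g y) = y) ∧
      (∀ x ∈ Set.Ico a b, f a ≤ f x ∧ g (f x) = x) ∧
      StrictMonoOn g (Set.Ici (f a)) ∧ Tendsto g atTop (𝓝 b) := by
  have hex : ∀ y, ∃ x, f a ≤ y → x ∈ Set.Ico a b ∧ f x = y := by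
    intro y
    by_cases hy : f a ≤ y
    · obtain ⟨s, hs1, hs2⟩ := ((ht.eventually_gt_atTop y).and (Ioo_mem_nhdsLT hab)).exists
      obtain ⟨x, hx, hxy⟩ := intermediate_value_Icc hs2.1.le
        (hc.mono fun r hr => ⟨hr.1, hr.2.trans_lt hs2.2⟩) ⟨hy, hs1.le⟩
      exact ⟨x, fun _ => ⟨⟨hx.1, hx.2.trans_lt hs2.2⟩, hxy⟩⟩
    · exact ⟨0, fun h => absurd h hy⟩
  choose g hg using hex
  have hleft : ∀ x ∈ Set.Ico a b, f a ≤ f x ∧ g (f x) = x := fun x hx => by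
    have h1 : f a ≤ f x := hf.monotoneOn ⟨le_rfl, hab⟩ hx hx.1
    exact ⟨h1, hf.injOn (hg _ h1).1 hx (hg _ h1).2⟩
  have hmono : StrictMonoOn g (Set.Ici (f a)) := fun y hy z hz hyz => by
    rw [← hf.lt_iff_lt (hg y hy).1 (hg z hz).1, (hg y hy).2, (hg z hz).2]
    exact hyz
  refine ⟨g, hg, hleft, hmono, tendsto_order.2 ⟨fun c hcb => ?_, fun c hcb => ?_⟩⟩
  · have hx : max a c ∈ Set.Ico a b := ⟨le_max_left _ _, max_lt hab hcb⟩
    filter_upwards [eventually_gt_atTop (f (max a c))] with y hy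
    have := hmono (hleft _ hx).1 ((hleft _ hx).1.trans hy.le) hy
    rw [(hleft _ hx).2] at this
    exact (le_max_right _ _).trans_lt this
  · filter_upwards [eventually_ge_atTop (f a)] with y hy
    exact (hg y hy).1.2.trans hcb

/-- A strictly decreasing continuous function on `[a, b]` has a strictly decreasing inverse on
`(f b, f a)`. -/
lemma StrictAntiOn.exists_inverse_Ioo {f : ℝ → ℝ} {a b : ℝ} (hab : a ≤ b)
    (hf : StrictAntiOn f (Set.Icc a b)) (hc : ContinuousOn f (Set.Icc a b)) :
    ∃ g : ℝ → ℝ, (∀ y ∈ Set.Ioo (f b) (f a), g y ∈ Set.Ioo a b ∧ f (g y) = y) ∧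
      (∀ x ∈ Set.Ioo a b, f x ∈ Set.Ioo (f b) (f a) ∧ g (f x) = x) ∧
      StrictAntiOn g (Set.Ioo (f b) (f a)) := by
  have hex : ∀ y, ∃ x, y ∈ Set.Ioo (f b) (f a) → x ∈ Set.Ioo a b ∧ f x = y := by
    intro y
    by_cases hy : y ∈ Set.Ioo (f b) (f a)
    · obtain ⟨x, hx, hxy⟩ := intermediate_value_Ioo' hab hc hy
      exact ⟨x, fun _ => ⟨hx, hxy⟩⟩
    · exact ⟨0, fun h => absurd h hy⟩
  choose g hg using hex
  have hsub : Set.Ioo a b ⊆ Set.Icc a b := Set.Ioo_subset_Icc_self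
  refine ⟨g, hg, fun x hx => ?_, fun y hy z hz hyz => ?_⟩
  · have h1 : f x ∈ Set.Ioo (f b) (f a) :=
      ⟨hf (hsub hx) ⟨hab, le_rfl⟩ hx.2, hf ⟨le_rfl, hab⟩ (hsub hx) hx.1⟩
    exact ⟨h1, hf.injOn (hsub (hg _ h1).1) (hsub hx) (hg _ h1).2⟩
  · rw [← hf.lt_iff_gt (hsub (hg y hy).1) (hsub (hg z hz).1), (hg y hy).2, (hg z hz).2]
    exact hyz

lemma ratioExponent_one (k m : ℝ) : ratioExponent k m 1 = k + m + 1 := if_pos rfl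

lemma one_lt_ratioExponent {k m r : ℝ} (hk : 0 < k) (hm : 0 < m) (h1 : 1 < r)
    (h2 : r < (k + 1) / k) : 1 < ratioExponent k m r := by
  have ha := weight_high_pos hm h1.le
  have hb := (lt_ratio_bound_iff hk).1 h2
  rw [ratioExponent, if_neg h1.ne', one_lt_div (Real.log_pos h1), logOdds,
    ← Real.log_div ha.ne' hb.ne']
  refine Real.log_lt_log (by linarith) ?_
  rw [lt_div_iff₀ hb]
  -- the difference of the two sides is `(r - 1) * (k * r + m)`
  nlinarith [mul_pos (sub_pos.2 h1) (by positivity : 0 < k * r + m)]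

/-- The ratios `r > 1` that solve `ratioExponent k m r = α`, for `k < m`: an increasing branch `ρ`
on `[A, ∞)` and a decreasing branch `ρ'` on `(A, k + m + 1)`. -/
theorem exists_branches_of_lt {k m : ℝ} (hk : 0 < k) (hm : 0 < m) (hkm : k < m) :
    ∃ (A : ℝ) (ρ ρ' : ℝ → ℝ), 1 < A ∧ A < k + m + 1 ∧
      (∀ α, A ≤ α → ρ α ∈ Set.Ioo 1 ((k + 1) / k)) ∧
      (∀ α, A < α → α < k + m + 1 → 1 < ρ' α ∧ ρ' α < ρ α) ∧
      StrictMonoOn ρ (Set.Ici A) ∧ StrictAntiOn ρ' (Set.Ioo A (k + m + 1)) ∧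
      (∀ r ∈ Set.Ioo 1 ((k + 1) / k), ∀ α, ratioExponent k m r = α ↔
        (A ≤ α ∧ r = ρ α) ∨ (A < α ∧ α < k + m + 1 ∧ r = ρ' α)) ∧
      (∀ α, A ≤ α → (0 < exponentSlope k m (ρ α) ↔ A < α)) ∧
      (∀ α, A < α → α < k + m + 1 → exponentSlope k m (ρ' α) < 0) ∧
      Tendsto ρ atTop (𝓝 ((k + 1) / k)) := by
  obtain ⟨r₀, hr₀, hz, hneg, hpos⟩ := exists_exponentSlope_sign hk hm hkm
  have hmono := strictMonoOn_ratioExponent hk hm hr₀.1.le hpos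
  have hanti := strictAntiOn_ratioExponent hk hm hr₀.2 hneg
  have hcont := continuousOn_ratioExponent hk hm
  obtain ⟨ρ, h1, h2, h3, h4⟩ := hmono.exists_inverse_Ici hr₀.2
    (hcont.mono (Set.Ico_subset_Ico_left hr₀.1.le)) (tendsto_ratioExponent hk hm)
  obtain ⟨ρ', h1', h2', h3'⟩ := hanti.exists_inverse_Ioo hr₀.1.le
    (hcont.mono fun r hr => ⟨hr.1, hr.2.trans_lt hr₀.2⟩)
  rw [ratioExponent_one] at h1' h2' h3'
  refine ⟨ratioExponent k m r₀, ρ, ρ', one_lt_ratioExponent hk hm hr₀.1 hr₀.2, ?_,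
    fun α hα => ⟨hr₀.1.trans_le (h1 α hα).1.1, (h1 α hα).1.2⟩,
    fun α hα hα' => ⟨(h1' α ⟨hα, hα'⟩).1.1,
      (h1' α ⟨hα, hα'⟩).1.2.trans_le (h1 α hα.le).1.1⟩, h3, h3', fun r hr α => ⟨?_, ?_⟩, ?_,
    fun α hα hα' => hneg _ (h1' α ⟨hα, hα'⟩).1, h4⟩
  · rw [← ratioExponent_one k m]
    exact hanti ⟨le_rfl, hr₀.1.le⟩ ⟨hr₀.1.le, le_rfl⟩ hr₀.1
  · rintro rfl
    rcases lt_or_ge r r₀ with h | h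
    · obtain ⟨h5, h6⟩ := h2' r ⟨hr.1, h⟩
      exact Or.inr ⟨h5.1, h5.2, h6.symm⟩
    · obtain ⟨h5, h6⟩ := h2 r ⟨h, hr.2⟩
      exact Or.inl ⟨h5, h6.symm⟩
  · rintro (⟨h5, rfl⟩ | ⟨h5, h6, rfl⟩)
    · exact (h1 α h5).2
    · exact (h1' α ⟨h5, h6⟩).2
  · intro α hα
    obtain ⟨h5, h6⟩ := h1 α hα
    refine ⟨fun h => hα.lt_of_ne ?_, fun h => hpos _ ⟨h5.1.lt_of_ne ?_, h5.2⟩⟩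
    · rintro rfl
      rw [(h2 r₀ ⟨le_rfl, hr₀.2⟩).2, hz] at h
      exact h.false
    · intro h7
      rw [← h7] at h6
      exact h.ne h6

/-- The ratios `r > 1` that solve `ratioExponent k m r = α`, for `m ≤ k`: one increasing branch on
`(k + m + 1, ∞)`. -/
theorem exists_branch_of_le {k m : ℝ} (hk : 0 < k) (hm : 0 < m) (hmk : m ≤ k) :
    ∃ ρ : ℝ → ℝ,
      (∀ α, k + m + 1 < α → ρ α ∈ Set.Ioo 1 ((k + 1) / k)) ∧
      StrictMonoOn ρ (Set.Ioi (k + m + 1)) ∧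
      (∀ r ∈ Set.Ioo 1 ((k + 1) / k), ∀ α, ratioExponent k m r = α ↔
        k + m + 1 < α ∧ r = ρ α) ∧
      (∀ α, k + m + 1 < α → 0 < exponentSlope k m (ρ α)) ∧
      Tendsto ρ atTop (𝓝 ((k + 1) / k)) := by
  have hpos := exponentSlope_pos hk hm hmk
  have hmono := strictMonoOn_ratioExponent hk hm le_rfl hpos
  have hR := one_lt_ratio_bound hk
  obtain ⟨ρ, h1, h2, h3, h4⟩ := hmono.exists_inverse_Ici hR
    (continuousOn_ratioExponent hk hm) (tendsto_ratioExponent hk hm)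
  rw [ratioExponent_one] at h1 h2 h3
  have hmem : ∀ α, k + m + 1 < α → ρ α ∈ Set.Ioo 1 ((k + 1) / k) := by
    intro α hα
    obtain ⟨h5, h6⟩ := h1 α hα.le
    refine ⟨h5.1.lt_of_ne fun h7 => ?_, h5.2⟩
    rw [← h7, ratioExponent_one] at h6
    exact hα.ne h6
  refine ⟨ρ, hmem, h3.mono Set.Ioi_subset_Ici_self, fun r hr α => ⟨?_, ?_⟩,
    fun α hα => hpos _ (hmem α hα), h4⟩
  · rintro rfl
    refine ⟨?_, (h2 r ⟨hr.1.le, hr.2⟩).2.symm⟩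
    rw [← ratioExponent_one k m]
    exact hmono ⟨le_rfl, hR⟩ ⟨hr.1.le, hr.2⟩ hr.1
  · rintro ⟨h5, rfl⟩
    exact (h1 α h5.le).2

/-! ### The field of the star graph and its equilibria -/

/-- The field of the star graph in closed form, with one coordinate for each edge: the centre
contributes the quotient over all edges, each leaf the quotient over its only edge. The latter is
`1` at a positive coordinate and `0` at a vanishing one. -/
noncomputable def starField {E : Type*} [Fintype E] (α : ℝ) (v : E → ℝ) (i : E) : ℝ :=
  -v i + (v i ^ α / v i ^ α + v i ^ α / ∑ j, v j ^ α) / (Fintype.card E + 1)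

/-- A law of the random subset under which the field is that of the star graph. -/
def HasStarField {E : Type*} [Fintype E] [DecidableEq E] (p : Finset E → ℝ) : Prop :=
  ∀ α v i, warmField p α v i = starField α v i

/-- A sum against `graphLaw` is an average over the vertices. -/
lemma sum_graphLaw_mul {V : Type*} [Fintype V] [DecidableEq V] (G : SimpleGraph V)
    [Fintype G.edgeSet] [DecidableEq G.edgeSet] (f : Finset G.edgeSet → ℝ) (i : G.edgeSet) :
    ∑ A : Finset G.edgeSet with i ∈ A, graphLaw G A * f A =
      (∑ x : V with x ∈ (i : Sym2 V),
        f ({e : G.edgeSet | x ∈ (e : Sym2 V)} : Finset G.edgeSet)) / Fintype.card V := by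
  set inc : V → Finset G.edgeSet := fun x => {e : G.edgeSet | x ∈ (e : Sym2 V)} with hinc
  have hcard : ∀ A, graphLaw G A = (({x : V | inc x = A} : Finset V).card : ℝ) / Fintype.card V := by
    intro A
    rw [graphLaw, ← Set.ncard_coe_finset]
    congr 3
    ext x
    simp only [hinc, Set.mem_ofPred_eq, Finset.coe_filter, Finset.mem_univ, true_and,
      Finset.ext_iff, Finset.mem_filter]
    exact forall_congr' fun _ => Iff.comm
  have h1 : ∀ A, (if i ∈ A then graphLaw G A * f A else 0) =
      ∑ x : V with inc x = A, (if i ∈ inc x then f (inc x) else 0) / Fintype.card V := by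
    intro A
    have : ∀ x ∈ ({x : V | inc x = A} : Finset V),
        (if i ∈ inc x then f (inc x) else 0) / (Fintype.card V : ℝ) =
          (if i ∈ A then f A else 0) / Fintype.card V := by
      intro x hx
      rw [(Finset.mem_filter.1 hx).2]
    rw [Finset.sum_congr rfl this, Finset.sum_const, nsmul_eq_mul, hcard]
    split_ifs <;> ring
  rw [Finset.sum_filter, Finset.sum_congr rfl fun A _ => h1 A, Finset.sum_fiberwise,
    ← Finset.sum_div, ← Finset.sum_filter]
  congr 2
  ext x
  simp [hinc]

lemma starEdge_eq (n : ℕ) (e : StarEdge n) : ∃ j : Fin (n + 1), j ≠ 0 ∧ (e : Sym2 _) = s(0, j) := by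
  obtain ⟨e, he⟩ := e
  induction e using Sym2.ind with
  | _ a b =>
    rw [SimpleGraph.mem_edgeSet, SimpleGraph.starGraph_adj] at he
    obtain ⟨hab, rfl | rfl⟩ := he
    · exact ⟨b, hab.symm, rfl⟩
    · exact ⟨a, hab, Sym2.eq_swap⟩

lemma card_starEdge (n : ℕ) : Fintype.card (StarEdge n) = n := by
  have h := (SimpleGraph.isTree_starGraph (0 : Fin (n + 1))).card_edgeFinset
  rw [SimpleGraph.edgeFinset_card, Fintype.card_fin] at h
  have h' : Fintype.card (StarEdge n) + 1 = n + 1 := by convert h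
  omega

lemma hasStarField_starLaw (n : ℕ) : HasStarField (starLaw n) := by
  intro α v i
  obtain ⟨j, hj, hij⟩ := starEdge_eq n i
  rw [warmField, starField, card_starEdge]
  congr 1
  rw [starLaw, sum_graphLaw_mul _ (fun A => v i ^ α / ∑ j ∈ A, v j ^ α) i, Fintype.card_fin]
  have h1 : (Finset.univ.filter fun x : Fin (n + 1) => x ∈ (i : Sym2 (Fin (n + 1)))) = {j, 0} := by
    ext x
    simp [hij, or_comm]
  have h0 : (Finset.univ.filter fun e : StarEdge n => (0 : Fin (n + 1)) ∈ (e : Sym2 _)) =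
      Finset.univ := by
    refine Finset.filter_true_of_mem fun e _ => ?_
    obtain ⟨l, -, hl⟩ := starEdge_eq n e
    rw [hl]
    exact Sym2.mem_mk_left _ _
  have hj' : (Finset.univ.filter fun e : StarEdge n => j ∈ (e : Sym2 _)) = {i} := by
    ext e
    obtain ⟨l, -, hl⟩ := starEdge_eq n e
    rw [Finset.mem_filter, Finset.mem_singleton, Subtype.ext_iff, hl, hij]
    simp only [Finset.mem_univ, Sym2.mem_iff, hj, false_or, true_and, Sym2.congr_right]
    exact eq_comm
  rw [h1, Finset.sum_pair hj, h0, hj', Finset.sum_singleton]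
  push_cast
  rfl

lemma sum_rpow_pos {E : Type*} [Fintype E] {α : ℝ} {v : E → ℝ} (h0 : ∀ i, 0 ≤ v i)
    (h1 : ∑ i, v i = 1) : 0 < ∑ i, v i ^ α := by
  obtain ⟨i, -, hi⟩ : ∃ i ∈ Finset.univ, 0 < v i := by
    by_contra! h
    linarith [Finset.sum_nonpos h]
  exact Finset.sum_pos' (fun i _ => Real.rpow_nonneg (h0 i) α)
    ⟨i, Finset.mem_univ i, Real.rpow_pos_of_pos hi α⟩

section Equilibria

variable {E : Type*} [Fintype E] [DecidableEq E] {p : Finset E → ℝ} {α : ℝ}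

/-- All coordinates of an equilibrium are positive, for otherwise the coordinates of the field
would add up to a negative number. -/
lemma isEquilibrium_iff_weights (hp : HasStarField p) (hα : 1 < α) (v : E → ℝ) :
    IsEquilibrium p α v ↔ (∀ i, 0 < v i) ∧ ∑ i, v i = 1 ∧
      ∀ i, (Fintype.card E + 1) * v i - 1 = v i ^ α / ∑ j, v j ^ α := by
  have hN : (0 : ℝ) < Fintype.card E + 1 := by positivity
  have key : ∀ i, 0 < v i → (warmField p α v i = 0 ↔
      (Fintype.card E + 1) * v i - 1 = v i ^ α / ∑ j, v j ^ α) := by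
    intro i hi
    rw [hp, starField, div_self (Real.rpow_pos_of_pos hi α).ne', neg_add_eq_zero,
      eq_div_iff hN.ne', sub_eq_iff_eq_add, mul_comm, add_comm (v i ^ α / _)]
  constructor
  · rintro ⟨h0, h1, h2⟩
    have hS : 0 < ∑ i, v i ^ α := sum_rpow_pos h0 h1
    have hsum : ∑ i, (1 - v i ^ α / v i ^ α) = 0 := by
      have h3 : ∑ i, starField α v i = 0 :=
        Finset.sum_eq_zero fun i _ => by rw [← hp, h2]
      simp only [starField, Finset.sum_add_distrib, Finset.sum_neg_distrib, ← Finset.sum_div, h1,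
        div_self hS.ne'] at h3
      rw [Finset.sum_sub_distrib, Finset.sum_const, Finset.card_univ, nsmul_eq_mul]
      field_simp at h3
      linarith
    have hpos : ∀ i, 0 < v i := by
      intro i
      have h4 := (Finset.sum_eq_zero_iff_of_nonneg
        (fun i _ => sub_nonneg.2 (div_self_le_one (v i ^ α)))).1 hsum i (Finset.mem_univ i)
      refine (h0 i).lt_of_ne fun h5 => ?_
      rw [← h5, Real.zero_rpow (by linarith)] at h4
      norm_num at h4
    exact ⟨hpos, h1, fun i => (key i (hpos i)).1 (h2 i)⟩
  · rintro ⟨h0, h1, h2⟩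
    exact ⟨fun i => (h0 i).le, h1, fun i => (key i (h0 i)).2 (h2 i)⟩

lemma isEquilibrium_uniform [Nonempty E] (hp : HasStarField p) (hα : 1 < α) :
    IsEquilibrium p α fun _ => 1 / (Fintype.card E : ℝ) := by
  have hN : (0 : ℝ) < Fintype.card E := by exact_mod_cast Fintype.card_pos
  rw [isEquilibrium_iff_weights hp hα]
  refine ⟨fun _ => by positivity, ?_, fun _ => ?_⟩
  · simp [hN.ne']
  · have : (0 : ℝ) < (1 / (Fintype.card E : ℝ)) ^ α := by positivity
    rw [Finset.sum_const, Finset.card_univ, nsmul_eq_mul]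
    field_simp
    ring

lemma IsTwoValued.sum_comp {k : ℕ} {a b : ℝ} {x : E → ℝ} (hx : IsTwoValued k a b x)
    (f : ℝ → ℝ) : ∑ i, f (x i) = k * f a + (Fintype.card E - k) * f b := by
  obtain ⟨S, rfl, ha, hb⟩ := hx
  rw [← Finset.sum_add_sum_compl S, Finset.sum_congr rfl fun i hi => by rw [ha i hi],
    Finset.sum_congr (s₁ := Sᶜ) rfl fun i hi => by rw [hb i (Finset.mem_compl.1 hi)]]
  rw [Finset.sum_const, Finset.sum_const, Finset.card_compl, nsmul_eq_mul, nsmul_eq_mul,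
    Nat.cast_sub (Finset.card_le_univ S)]

lemma ratioExponent_eq_iff {k m r α : ℝ} (hk : 0 < k) (hm : 0 < m) (h1 : 1 < r)
    (h2 : r < (k + 1) / k) :
    ratioExponent k m r = α ↔ ((m + 1) * r - m) / (k + 1 - k * r) = r ^ α := by
  have ha := weight_high_pos hm h1.le
  have hb := (lt_ratio_bound_iff hk).1 h2
  have hr : 0 < r := by linarith
  have hl := Real.log_pos h1
  rw [ratioExponent, if_neg h1.ne', div_eq_iff hl.ne', logOdds, ← Real.log_div ha.ne' hb.ne',
    ← Real.log_rpow hr]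
  exact Real.log_injOn_pos.eq_iff (div_pos ha hb) (Real.rpow_pos_of_pos hr α)

/-- A two-valued vector of ratio `r` is an equilibrium for the exponent belonging to `r`. -/
lemma isEquilibrium_of_isTwoValued (hp : HasStarField p) (hα : 1 < α) {k : ℕ} {m r : ℝ}
    (hk : 0 < k) (hkm : (Fintype.card E : ℝ) - k = m) (hm : 0 < m) (h1 : 1 < r)
    (h2 : r < ((k : ℝ) + 1) / k) (hr : ratioExponent k m r = α) {x : E → ℝ}
    (hx : IsTwoValued k (r / (k * r + m)) (1 / (k * r + m)) x) : IsEquilibrium p α x := by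
  have hk' : (0 : ℝ) < k := by exact_mod_cast hk
  have hb := (lt_ratio_bound_iff hk').1 h2
  have hr0 : 0 < r := by linarith
  have hd : 0 < k * r + m := by positivity
  have hN : (Fintype.card E : ℝ) = k + m := by linarith
  rw [ratioExponent_eq_iff hk' hm h1 h2] at hr
  have hu : 0 < (1 / (k * r + m)) ^ α := by positivity
  have hv : (r / (k * r + m)) ^ α =
      ((m + 1) * r - m) / (k + 1 - k * r) * (1 / (k * r + m)) ^ α := by
    rw [hr, ← Real.mul_rpow hr0.le (by positivity), mul_one_div]
  have hS := hx.sum_comp fun t => t ^ α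
  have hsum := hx.sum_comp fun t => t
  simp only [hkm] at hS hsum
  rw [isEquilibrium_iff_weights hp hα, hS, hsum, hN, hv]
  have hval : ∀ i, x i = r / (k * r + m) ∨ x i = 1 / (k * r + m) := by
    obtain ⟨S, -, hS1, hS2⟩ := hx
    exact fun i => (em (i ∈ S)).imp (hS1 i) (hS2 i)
  set U := (1 / (k * r + m)) ^ α with hU
  have htot : k * (((m + 1) * r - m) / (k + 1 - k * r) * U) + m * U =
      (k * r + m) / (k + 1 - k * r) * U := by
    field_simp
    ring
  refine ⟨fun i => ?_, ?_, fun i => ?_⟩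
  · rcases hval i with h | h <;> rw [h] <;> positivity
  · field_simp
  · rw [htot]
    rcases hval i with h | h <;> rw [h]
    · rw [hv, mul_div_mul_right _ _ hu.ne', div_div_div_cancel_right₀ hb.ne', eq_div_iff hd.ne']
      field_simp
      ring
    · rw [← hU, div_mul_eq_mul_div, div_div_eq_mul_div, mul_comm U, mul_div_mul_right _ _ hu.ne',
        eq_div_iff hd.ne']
      field_simp
      ring

/-- A strictly convex power meets a line in at most two points. -/
lemma no_three_weights {N S a b c : ℝ} (hα : 1 < α) (hS : 0 < S) (ha : 0 < a) (hac : a < c)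
    (hcb : c < b) (h1 : (N + 1) * a - 1 = a ^ α / S) (h2 : (N + 1) * c - 1 = c ^ α / S)
    (h3 : (N + 1) * b - 1 = b ^ α / S) : False := by
  have h := (strictConvexOn_rpow hα).slope_strict_mono_adjacent (x := a) (y := c) (z := b)
    ha.le (ha.trans (hac.trans hcb)).le hac hcb
  rw [eq_div_iff hS.ne'] at h1 h2 h3
  simp only [← h1, ← h2, ← h3] at h
  rw [div_lt_div_iff₀ (sub_pos.2 hac) (sub_pos.2 hcb)] at h
  linarith

/-- Besides the uniform vector, the equilibria are the two-valued vectors whose ratio belongs to the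
exponent. -/
theorem isEquilibrium_iff [Nonempty E] (hp : HasStarField p) (hα : 1 < α) (x : E → ℝ) :
    IsEquilibrium p α x ↔ x = (fun _ => 1 / (Fintype.card E : ℝ)) ∨
      ∃ k : ℕ, 0 < k ∧ k < Fintype.card E ∧ ∃ r ∈ Set.Ioo 1 (((k : ℝ) + 1) / k),
        ratioExponent k (Fintype.card E - k) r = α ∧
        IsTwoValued k (r / (k * r + (Fintype.card E - k)))
          (1 / (k * r + (Fintype.card E - k))) x := by
  constructor
  · intro hx
    obtain ⟨hpos, hsum, hw⟩ := (isEquilibrium_iff_weights hp hα x).1 hx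
    have hS : 0 < ∑ i, x i ^ α := sum_rpow_pos (fun i => (hpos i).le) hsum
    obtain ⟨i₀, hmax⟩ := Finite.exists_max x
    obtain ⟨i₁, hmin⟩ := Finite.exists_min x
    have hN : (0 : ℝ) < Fintype.card E := by exact_mod_cast Fintype.card_pos
    rcases (hmax i₁).eq_or_lt with heq | hlt
    · left
      have hc : ∀ i, x i = x i₀ := fun i => le_antisymm (hmax i) (heq ▸ hmin i)
      rw [Finset.sum_congr rfl fun i _ => hc i, Finset.sum_const, Finset.card_univ,
        nsmul_eq_mul] at hsum
      funext i
      rw [hc i, eq_div_iff hN.ne', mul_comm, hsum]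
    · right
      have hval : ∀ i, x i ≠ x i₀ → x i = x i₁ := by
        intro i hi
        by_contra hi'
        exact no_three_weights hα hS (hpos i₁) ((hmin i).lt_of_ne (Ne.symm hi'))
          ((hmax i).lt_of_ne hi) (hw i₁) (hw i) (hw i₀)
      set T := Finset.univ.filter fun i => x i = x i₀ with hT
      have htwo : IsTwoValued T.card (x i₀) (x i₁) x :=
        ⟨T, rfl, fun e he => (Finset.mem_filter.1 he).2, fun e he => hval e fun h => he (by
          rw [hT]; simpa using h)⟩
      have hT0 : 0 < T.card := Finset.card_pos.2 ⟨i₀, by simp [hT]⟩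
      have hTN : T.card < Fintype.card E :=
        Finset.card_lt_univ_of_notMem (x := i₁) (by simpa [hT] using hlt.ne)
      obtain ⟨m, hm⟩ : ∃ m : ℝ, m = Fintype.card E - T.card := ⟨_, rfl⟩
      have hm0 : 0 < m := by rw [hm, sub_pos]; exact_mod_cast hTN
      have hk0 : (0 : ℝ) < T.card := by exact_mod_cast hT0
      have hsum' := htwo.sum_comp fun t => t
      simp only [hsum] at hsum'
      have hb := hpos i₁
      have ha := hpos i₀
      obtain ⟨k, hk⟩ : ∃ k : ℝ, k = T.card := ⟨_, rfl⟩
      rw [← hk] at hm hk0 hsum'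
      obtain ⟨r, hr⟩ : ∃ r, r = x i₀ / x i₁ := ⟨_, rfl⟩
      have har : x i₀ = r * x i₁ := by rw [hr, div_mul_cancel₀ _ hb.ne']
      have hr1 : 1 < r := by rwa [hr, one_lt_div hb]
      have hd : 0 < k * r + m := by positivity
      have hbr : x i₁ = 1 / (k * r + m) := by
        rw [eq_div_iff hd.ne', hsum', har, hm]; ring
      have hNkm : (Fintype.card E : ℝ) = k + m := by rw [hm]; ring
      have hdb : (k * r + m) * x i₁ = 1 := by rw [hbr, mul_one_div_cancel hd.ne']
      have hwb : (Fintype.card E + 1) * x i₁ - 1 = (k + 1 - k * r) * x i₁ := by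
        rw [hNkm]; linear_combination hdb
      have hwa : (Fintype.card E + 1) * x i₀ - 1 = ((m + 1) * r - m) * x i₁ := by
        rw [hNkm, har]; linear_combination hdb
      have hw1 := hw i₁
      have hw0 := hw i₀
      rw [hwb] at hw1
      rw [hwa] at hw0
      have hB : 0 < x i₁ ^ α := Real.rpow_pos_of_pos hb α
      have hpb : 0 < k + 1 - k * r := by
        have : 0 < (k + 1 - k * r) * x i₁ := by rw [hw1]; positivity
        exact pos_of_mul_pos_left this hb.le
      have hr2 : r < (k + 1) / k := (lt_ratio_bound_iff hk0).2 hpb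
      refine ⟨T.card, hT0, hTN, r, ⟨hr1, hk ▸ hr2⟩, ?_, ?_⟩
      · rw [← hk, ← hm, ratioExponent_eq_iff hk0 hm0 hr1 hr2,
          ← mul_div_mul_right _ _ hb.ne', hw0, hw1, div_div_div_cancel_right₀ hS.ne', hr,
          Real.div_rpow ha.le hb.le]
      · have : r / (k * r + m) = x i₀ := by rw [har, hbr, mul_one_div]
        rw [← hk, ← hm, this, ← hbr]
        exact htwo
  · rintro (rfl | ⟨k, hk, hkN, r, hr, hrα, hx⟩)
    · exact isEquilibrium_uniform hp hα
    · refine isEquilibrium_of_isTwoValued hp hα hk rfl ?_ hr.1 hr.2 hrα hx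
      rw [sub_pos]
      exact_mod_cast hkN

end Equilibria

/-! ### The matrix of partial derivatives and its eigenvalues -/

/-- The matrix of partial derivatives at an equilibrium of the star graph, in terms of the shares
`w i = v i ^ α / ∑ j, v j ^ α = (n + 1) * v i - 1`. -/
noncomputable def stabilityMatrix {E : Type*} [DecidableEq E] (α : ℝ) (w : E → ℝ) :
    Matrix E E ℝ :=
  fun i k => (if i = k then -1 + α * w i / (1 + w i) else 0) - α * w i * w k / (1 + w k)

/-- The columns of `stabilityMatrix α w + 1` add up to zero, so an eigenvector of eigenvalue other
than `-1` has sum zero. -/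
lemma eigenvector_sum_mul {E : Type*} [Fintype E] {α : ℝ} {w : E → ℝ} (hsum : ∑ i, w i = 1) {μ : ℂ} {x : E → ℂ}
    (hx : ∀ i, (-1 + α * w i / (1 + w i)) * x i - α * w i * ∑ k, w k / (1 + w k) * x k = μ * x i) :
    (μ + 1) * ∑ i, x i = 0 := by
  have h1 : ∑ i, μ * x i = ∑ i, ((-1 + α * w i / (1 + w i)) * x i -
      α * w i * ∑ k, w k / (1 + w k) * x k) := Finset.sum_congr rfl fun i _ => (hx i).symm
  have h2 : ∑ i, (w i : ℂ) = 1 := by exact_mod_cast hsum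
  rw [Finset.sum_sub_distrib, ← Finset.sum_mul, ← Finset.mul_sum, ← Finset.mul_sum, h2] at h1
  have h3 : ∑ i, (-1 + α * w i / (1 + w i)) * x i =
      -∑ i, x i + α * ∑ k, (w k : ℂ) / (1 + w k) * x k := by
    rw [Finset.mul_sum, ← Finset.sum_neg_distrib, ← Finset.sum_add_distrib]
    exact Finset.sum_congr rfl fun i _ => by ring
  rw [h3] at h1
  linear_combination h1

lemma eigenvector_sub_mul {E : Type*} [Fintype E] {α : ℝ} {w : E → ℝ} {μ : ℂ} {x : E → ℂ}
    (hx : ∀ i, (-1 + α * w i / (1 + w i)) * x i - α * w i * ∑ k, w k / (1 + w k) * x k = μ * x i)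
    {i j : E} (hij : w i = w j) :
    ((-1 + α * w i / (1 + w i) : ℝ) - μ) * (x i - x j) = 0 := by
  have h1 := hx i
  have h2 := hx j
  rw [← hij] at h2
  push_cast
  linear_combination h1 - h2

section Stability

variable {E : Type*} [Fintype E] [DecidableEq E] {p : Finset E → ℝ} {α : ℝ}

lemma isPartialsMatrix_stabilityMatrix (hp : HasStarField p) (hα : 1 < α) {v : E → ℝ}
    (hv : IsEquilibrium p α v) :
    IsPartialsMatrix p α v (stabilityMatrix α fun i => (Fintype.card E + 1) * v i - 1) := by
  obtain ⟨hpos, hsum, hw⟩ := (isEquilibrium_iff_weights hp hα v).1 hv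
  have hS : 0 < ∑ i, v i ^ α := sum_rpow_pos (fun i => (hpos i).le) hsum
  have hN : (0 : ℝ) < Fintype.card E + 1 := by positivity
  intro i k
  simp only [hp α _ i, starField]
  have hupd : Function.update v k (v k) = v := Function.update_eq_self k v
  have d0 : ∀ j, HasDerivAt (fun s => Function.update v k s j) ((Pi.single k 1 : E → ℝ) j) (v k) :=
    hasDerivAt_pi.1 (hasDerivAt_update v k (v k))
  have d1 : ∀ j, HasDerivAt (fun s => Function.update v k s j ^ α)
      ((Pi.single k 1 : E → ℝ) j * α * v j ^ (α - 1)) (v k) := by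
    intro j
    have := (d0 j).rpow_const (p := α) (Or.inr hα.le)
    rwa [hupd] at this
  have d2 : HasDerivAt (fun s => ∑ j, Function.update v k s j ^ α)
      (α * v k ^ (α - 1)) (v k) := by
    refine (HasDerivAt.fun_sum fun j _ => d1 j).congr_deriv ?_
    rw [Finset.sum_eq_single k]
    · simp
    · intro j _ hj
      simp [Pi.single_eq_of_ne hj]
    · simp
  have hP : 0 < v i ^ α := Real.rpow_pos_of_pos (hpos i) α
  have d3 : HasDerivAt (fun s => Function.update v k s i ^ α / Function.update v k s i ^ α) 0
      (v k) := ((d1 i).fun_div (d1 i) (by rw [hupd]; exact hP.ne')).congr_deriv (by ring)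
  have d4 := (d1 i).fun_div d2 (by rw [hupd]; exact hS.ne')
  refine ((d0 i).fun_neg.fun_add ((d3.fun_add d4).div_const _)).congr_deriv ?_
  simp only [hupd]
  have hpow : ∀ j, v j ^ (α - 1) = v j ^ α / v j := fun j => Real.rpow_sub_one (hpos j).ne' α
  have hw' : ∀ j, v j ^ α = ((Fintype.card E + 1) * v j - 1) * ∑ l, v l ^ α := fun j => by
    rw [hw j, div_mul_cancel₀ _ hS.ne']
  have hvi := hpos i
  have hvk := hpos k
  simp only [stabilityMatrix, hpow]
  rw [zero_add, hw' i, hw' k]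
  set S := ∑ l, v l ^ α
  set N : ℝ := (Fintype.card E : ℝ)
  have e1 : 1 + ((N + 1) * v i - 1) = (N + 1) * v i := by ring
  have e2 : 1 + ((N + 1) * v k - 1) = (N + 1) * v k := by ring
  rw [e1, e2]
  by_cases hik : i = k
  · subst hik
    rw [if_pos rfl, Pi.single_eq_same]
    field_simp
    ring
  · rw [if_neg hik, Pi.single_eq_of_ne hik]
    field_simp
    ring

lemma isPartialsMatrix_unique {v : E → ℝ} {D D' : Matrix E E ℝ} (h : IsPartialsMatrix p α v D)
    (h' : IsPartialsMatrix p α v D') : D = D' := by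
  ext i k
  exact (h i k).unique (h' i k)

lemma isLinearlyStable_iff (hp : HasStarField p) (hα : 1 < α) {v : E → ℝ}
    (hv : IsEquilibrium p α v) :
    IsLinearlyStable p α v ↔ ∀ μ : ℂ, IsComplexEigenvalue
      (stabilityMatrix α fun i => (Fintype.card E + 1) * v i - 1) μ → μ.re < 0 := by
  have hD := isPartialsMatrix_stabilityMatrix hp hα hv
  constructor
  · rintro ⟨-, D, hD', h⟩
    rwa [isPartialsMatrix_unique hD' hD] at h
  · exact fun h => ⟨hv, _, hD, h⟩

lemma isLinearlyUnstable_iff (hp : HasStarField p) (hα : 1 < α) {v : E → ℝ}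
    (hv : IsEquilibrium p α v) :
    IsLinearlyUnstable p α v ↔ ∃ μ : ℂ, IsComplexEigenvalue
      (stabilityMatrix α fun i => (Fintype.card E + 1) * v i - 1) μ ∧ 0 < μ.re := by
  have hD := isPartialsMatrix_stabilityMatrix hp hα hv
  constructor
  · rintro ⟨-, D, hD', h⟩
    rwa [isPartialsMatrix_unique hD' hD] at h
  · exact fun h => ⟨hv, _, hD, h⟩

lemma isComplexEigenvalue_stabilityMatrix {w : E → ℝ} {μ : ℂ} :
    IsComplexEigenvalue (stabilityMatrix α w) μ ↔ ∃ x : E → ℂ, x ≠ 0 ∧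
      ∀ i, (-1 + α * w i / (1 + w i)) * x i - α * w i * ∑ k, w k / (1 + w k) * x k = μ * x i := by
  have key : ∀ (x : E → ℂ) (i : E),
      Matrix.toLin' ((stabilityMatrix α w).map Complex.ofReal) x i =
        (-1 + α * w i / (1 + w i)) * x i - α * w i * ∑ k, w k / (1 + w k) * x k := by
    intro x i
    rw [Matrix.toLin'_apply, Matrix.mulVec, dotProduct]
    simp only [Matrix.map_apply, stabilityMatrix, Complex.ofReal_sub, sub_mul,
      Finset.sum_sub_distrib, Finset.mul_sum]
    congr 1
    · rw [Finset.sum_eq_single i]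
      · simp
      · intro j _ hj
        simp [hj.symm]
      · simp
    · refine Finset.sum_congr rfl fun k _ => ?_
      push_cast
      ring
  constructor
  · intro h
    obtain ⟨x, hx⟩ := h.exists_hasEigenvector
    refine ⟨x, hx.2, fun i => ?_⟩
    rw [← key, hx.apply_eq_smul, Pi.smul_apply, smul_eq_mul]
  · rintro ⟨x, hx0, hx⟩
    refine Module.End.hasEigenvalue_of_hasEigenvector (x := x)
      ⟨Module.End.mem_eigenspace_iff.2 ?_, hx0⟩
    funext i
    rw [key, hx, Pi.smul_apply, smul_eq_mul]

/-- Two edges of equal share give an eigenvector supported on them. -/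
lemma isComplexEigenvalue_of_eq {w : E → ℝ} {i j : E} (hne : i ≠ j) (hij : w i = w j) :
    IsComplexEigenvalue (stabilityMatrix α w) ((-1 + α * w i / (1 + w i) : ℝ) : ℂ) := by
  rw [isComplexEigenvalue_stabilityMatrix]
  refine ⟨Pi.single i 1 - Pi.single j 1, fun h => ?_, fun l => ?_⟩
  · have := congrFun h i
    simp [hne] at this
  · have h0 : ∑ k, (w k : ℂ) / (1 + w k) * (Pi.single i 1 - Pi.single j 1 : E → ℂ) k = 0 := by
      simp [mul_sub, Finset.sum_sub_distrib, Pi.single_apply, hij]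
    rw [h0]
    push_cast
    by_cases h1 : l = i
    · subst h1
      simp
    · by_cases h2 : l = j
      · subst h2
        simp [hij]
      · simp [h1, h2]

/-- Two classes of edges give an eigenvector that is constant on each class and of sum zero. -/
lemma isComplexEigenvalue_of_isTwoValued {w : E → ℝ} {k : ℕ} {a b m : ℝ} (hk : 0 < k)
    (hm : 0 < m) (hkm : (Fintype.card E : ℝ) - k = m) (ha : 0 < a) (hb : 0 < b)
    (hab : k * a + m * b = 1) (hw : IsTwoValued k a b w) :
    IsComplexEigenvalue (stabilityMatrix α w)
      ((α * a * b * (m / (1 + a) + k / (1 + b)) - 1 : ℝ) : ℂ) := by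
  rw [isComplexEigenvalue_stabilityMatrix]
  obtain ⟨S, rfl, hS, hS'⟩ := hw
  obtain ⟨i₀, hi₀⟩ := Finset.card_pos.1 hk
  obtain ⟨y, hyS, hyS'⟩ : ∃ y : E → ℝ, (∀ i ∈ S, y i = m) ∧ ∀ i ∉ S, y i = -S.card :=
    ⟨fun i => if i ∈ S then m else -S.card, fun i hi => if_pos hi, fun i hi => if_neg hi⟩
  refine ⟨fun i => (y i : ℂ), fun h => ?_, fun i => ?_⟩
  · have := congrFun h i₀
    simp [hyS i₀ hi₀, hm.ne'] at this
  · have hsum : ∑ l, w l / (1 + w l) * y l = S.card * m * (a / (1 + a) - b / (1 + b)) := by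
      rw [← Finset.sum_add_sum_compl S,
        Finset.sum_congr rfl fun l hl => by rw [hS l hl, hyS l hl],
        Finset.sum_congr (s₁ := Sᶜ) rfl fun l hl => by
          rw [hS' l (Finset.mem_compl.1 hl), hyS' l (Finset.mem_compl.1 hl)],
        Finset.sum_const, Finset.sum_const, Finset.card_compl, nsmul_eq_mul, nsmul_eq_mul,
        Nat.cast_sub (Finset.card_le_univ S), hkm]
      ring
    have h : (-1 + α * w i / (1 + w i)) * y i - α * w i * ∑ l, w l / (1 + w l) * y l =
        (α * a * b * (m / (1 + a) + S.card / (1 + b)) - 1) * y i := by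
      rw [hsum]
      by_cases hi : i ∈ S
      · rw [hS i hi, hyS i hi]
        field_simp
        linear_combination (-(α * a * (1 + b))) * hab
      · rw [hS' i hi, hyS' i hi]
        field_simp
        linear_combination (α * b * (1 + a)) * hab
    have hC := congrArg Complex.ofReal h
    push_cast at hC ⊢
    exact hC

/-- If one edge is singled out and all others have equal share, the eigenvalues are `-1`, the one
on the vectors supported on the other edges, and the one on the vectors constant there. -/
lemma re_neg_of_isTwoValued_one {w : E → ℝ} {a b m : ℝ} (hm : 0 < m)
    (hkm : (Fintype.card E : ℝ) - 1 = m) (ha : 0 < a) (hb : 0 < b) (hab : a + m * b = 1)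
    (hw : IsTwoValued 1 a b w) (h1 : -1 + α * b / (1 + b) < 0)
    (h2 : α * a * b * (m / (1 + a) + 1 / (1 + b)) - 1 < 0) {μ : ℂ}
    (hμ : IsComplexEigenvalue (stabilityMatrix α w) μ) : μ.re < 0 := by
  obtain ⟨x, hx0, hx⟩ := isComplexEigenvalue_stabilityMatrix.1 hμ
  have hsum : ∑ i, w i = 1 := by
    have := hw.sum_comp fun t => t
    rw [this, Nat.cast_one, hkm]
    linarith
  obtain ⟨S, hS, hSa, hSb⟩ := hw
  obtain ⟨o, rfl⟩ := Finset.card_eq_one.1 hS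
  have hwo : w o = a := hSa o (Finset.mem_singleton_self o)
  have hwb : ∀ i, i ≠ o → w i = b := fun i hi => hSb i (by simpa using hi)
  by_contra hre
  have hne : ∀ t : ℝ, t < 0 → (t : ℂ) - μ ≠ 0 := fun t ht h => hre (by
    rw [← sub_eq_zero.1 h]; simpa using ht)
  have hcard : 0 < ({o}ᶜ : Finset E).card := by
    rw [Finset.card_compl, Finset.card_singleton]
    have : (1 : ℝ) < Fintype.card E := by linarith
    have : 1 < Fintype.card E := by exact_mod_cast this
    omega
  obtain ⟨j, hj⟩ := Finset.card_pos.1 hcard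
  have hjo : j ≠ o := by simpa using hj
  have hxj : ∀ i, i ≠ o → x i = x j := by
    intro i hi
    have := eigenvector_sub_mul hx (i := i) (j := j) (by rw [hwb i hi, hwb j hjo])
    rw [hwb i hi] at this
    exact sub_eq_zero.1 ((mul_eq_zero.1 this).resolve_left (hne _ h1))
  have hs : ∑ i, x i = 0 := by
    refine (mul_eq_zero.1 (eigenvector_sum_mul hsum hx)).resolve_left fun h => ?_
    refine hne (-1) (by norm_num) ?_
    push_cast
    linear_combination -h
  have hmC : ((({o}ᶜ : Finset E).card : ℕ) : ℂ) = m := by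
    rw [Finset.card_compl, Finset.card_singleton, Nat.cast_sub (by
      by_contra! h
      have : Fintype.card E = 0 := by omega
      rw [this] at hkm
      norm_num at hkm
      linarith), ← hkm]
    push_cast
    rfl
  have hsplit : ∀ f : E → ℂ, ∑ i, f i = f o + ∑ i ∈ ({o}ᶜ : Finset E), f i := fun f => by
    rw [← Finset.sum_add_sum_compl {o}, Finset.sum_singleton]
  have hxo : x o = -m * x j := by
    rw [hsplit, Finset.sum_congr rfl fun i hi => hxj i (by simpa using hi), Finset.sum_const,
      nsmul_eq_mul, hmC] at hs
    linear_combination hs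
  have hxj0 : x j ≠ 0 := by
    intro h
    refine hx0 (funext fun i => ?_)
    by_cases hi : i = o
    · rw [hi, hxo, h, mul_zero, Pi.zero_apply]
    · rw [hxj i hi, h, Pi.zero_apply]
  have hsum' : ∑ l, (w l : ℂ) / (1 + w l) * x l = m * (b / (1 + b) - a / (1 + a)) * x j := by
    rw [hsplit, Finset.sum_congr rfl fun i hi => by
      rw [hxj i (by simpa using hi), hwb i (by simpa using hi)], Finset.sum_const, nsmul_eq_mul,
      hmC, hwo, hxo]
    ring
  have hj := hx j
  rw [hsum', hwb j hjo] at hj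
  refine hne _ h2 ((mul_eq_zero.1 (?_ : _ * x j = 0)).resolve_right hxj0)
  have habC : (a : ℂ) + m * b = 1 := by exact_mod_cast hab
  have ha1 : (1 + a : ℂ) ≠ 0 := by
    have : (1 + a : ℝ) ≠ 0 := by positivity
    exact_mod_cast this
  have hb1 : (1 + b : ℂ) ≠ 0 := by
    have : (1 + b : ℝ) ≠ 0 := by positivity
    exact_mod_cast this
  push_cast
  have e : (α * b / (1 + b) - α * b * (m * (b / (1 + b) - a / (1 + a))) : ℂ) =
      α * a * b * (m / (1 + a) + 1 / (1 + b)) := by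
    field_simp
    linear_combination (-(α * b * (1 + a)) : ℂ) * habC
  linear_combination hj - x j * e

end Stability

/-! ### Linear stability of the equilibria -/

lemma uniform_weights {E : Type*} [Fintype E] [Nonempty E] :
    (fun _ : E => (Fintype.card E + 1) * (1 / (Fintype.card E : ℝ)) - 1) =
      fun _ => 1 / (Fintype.card E : ℝ) := by
  have hN : (0 : ℝ) < Fintype.card E := by exact_mod_cast Fintype.card_pos
  funext
  field_simp
  ring

section StabilityOfEquilibria

variable {E : Type*} [Fintype E] [DecidableEq E] {p : Finset E → ℝ} {α : ℝ}

lemma isComplexEigenvalue_const (hE : 1 < Fintype.card E) :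
    IsComplexEigenvalue (stabilityMatrix (E := E) α fun _ => 1 / (Fintype.card E : ℝ))
      ((α / (Fintype.card E + 1) - 1 : ℝ) : ℂ) := by
  obtain ⟨i, j, hij⟩ := Fintype.one_lt_card_iff.1 hE
  have hN : (0 : ℝ) < Fintype.card E := by exact_mod_cast zero_lt_one.trans hE
  convert isComplexEigenvalue_of_eq (α := α) (w := fun _ => 1 / (Fintype.card E : ℝ)) hij rfl
    using 2
  field_simp
  ring

/-- At the uniform vector an eigenvector is either constant or has an eigenvalue common to all
differences of two edges. -/
lemma eq_of_isComplexEigenvalue_const (hE : 1 < Fintype.card E) {μ : ℂ}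
    (hμ : IsComplexEigenvalue (stabilityMatrix (E := E) α fun _ => 1 / (Fintype.card E : ℝ)) μ) :
    μ = ((α / (Fintype.card E + 1) - 1 : ℝ) : ℂ) ∨ μ = -1 := by
  have hN : (0 : ℝ) < Fintype.card E := by exact_mod_cast zero_lt_one.trans hE
  obtain ⟨x, hx0, hx⟩ := isComplexEigenvalue_stabilityMatrix.1 hμ
  have hsum : ∑ _ : E, 1 / (Fintype.card E : ℝ) = 1 := by simp [hN.ne']
  have ht : -1 + α * (1 / (Fintype.card E : ℝ)) / (1 + 1 / (Fintype.card E : ℝ)) =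
      α / (Fintype.card E + 1) - 1 := by
    field_simp
    ring
  by_contra! h
  have hconst : ∀ i j, x i = x j := by
    intro i j
    have h1 := eigenvector_sub_mul hx (i := i) (j := j) rfl
    rw [ht] at h1
    exact sub_eq_zero.1 ((mul_eq_zero.1 h1).resolve_left (sub_ne_zero.2 h.1.symm))
  obtain ⟨i, hi⟩ := Function.ne_iff.1 hx0
  have h2 := (mul_eq_zero.1 (eigenvector_sum_mul hsum hx)).resolve_left
    fun h3 => h.2 (eq_neg_of_add_eq_zero_left h3)
  rw [Finset.sum_congr rfl fun j _ => hconst j i, Finset.sum_const, Finset.card_univ,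
    nsmul_eq_mul] at h2
  refine hi ((mul_eq_zero.1 h2).resolve_left ?_)
  exact_mod_cast hN.ne'

theorem isLinearlyStable_uniform_iff (hp : HasStarField p) (hα : 1 < α)
    (hE : 1 < Fintype.card E) :
    IsLinearlyStable p α (fun _ => 1 / (Fintype.card E : ℝ)) ↔ α < Fintype.card E + 1 := by
  have : Nonempty E := Fintype.card_pos_iff.1 (zero_lt_one.trans hE)
  have hN : (0 : ℝ) < Fintype.card E + 1 := by positivity
  rw [isLinearlyStable_iff hp hα (isEquilibrium_uniform hp hα), uniform_weights]
  constructor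
  · intro h
    have := h _ (isComplexEigenvalue_const hE)
    rwa [Complex.ofReal_re, sub_neg, div_lt_one hN] at this
  · intro h μ hμ
    rcases eq_of_isComplexEigenvalue_const hE hμ with rfl | rfl
    · rwa [Complex.ofReal_re, sub_neg, div_lt_one hN]
    · norm_num

theorem isCritical_uniform (hp : HasStarField p) (hE : 1 < Fintype.card E) :
    IsCritical p ((Fintype.card E : ℝ) + 1) fun _ => 1 / (Fintype.card E : ℝ) := by
  have : Nonempty E := Fintype.card_pos_iff.1 (zero_lt_one.trans hE)
  have hN : (0 : ℝ) < Fintype.card E := by exact_mod_cast Fintype.card_pos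
  have hα : (1 : ℝ) < Fintype.card E + 1 := by linarith
  have heq := isEquilibrium_uniform hp hα
  refine ⟨heq, ⟨_, isPartialsMatrix_stabilityMatrix hp hα heq⟩, fun h => ?_, fun h => ?_⟩
  · exact lt_irrefl _ ((isLinearlyStable_uniform_iff hp hα hE).1 h)
  · rw [isLinearlyUnstable_iff hp hα heq, uniform_weights] at h
    obtain ⟨μ, hμ, hre⟩ := h
    rcases eq_of_isComplexEigenvalue_const hE hμ with rfl | rfl
    · rw [div_self (by linarith), sub_self, Complex.ofReal_zero, Complex.zero_re] at hre
      exact hre.false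
    · norm_num at hre

/-- The eigenvalue on the vectors that are constant on both classes is negative exactly where the
exponent increases with the ratio. -/
lemma exponentSlope_pos_iff {k m r : ℝ} (hk : 0 < k) (hm : 0 < m) (h1 : 1 < r)
    (h2 : r < (k + 1) / k) (hr : ratioExponent k m r = α) :
    0 < exponentSlope k m r ↔
      α * (((m + 1) * r - m) * (k + 1 - k * r)) / ((k + m + 1) * r) - 1 < 0 := by
  have ha := weight_high_pos hm h1.le
  have hb := (lt_ratio_bound_iff hk).1 h2
  have hl := Real.log_pos h1
  have hr0 : 0 < r := by linarith
  rw [ratioExponent, if_neg h1.ne', div_eq_iff hl.ne'] at hr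
  have e : exponentSlope k m r =
      Real.log r * (r * (k + m + 1) / (((m + 1) * r - m) * (k + 1 - k * r)) - α) := by
    rw [exponentSlope, hr]
    ring
  have hP := mul_pos ha hb
  rw [e, mul_pos_iff_of_pos_left hl, sub_pos, lt_div_iff₀ hP, sub_neg,
    div_lt_one (by positivity), mul_comm r]

/-- A two-valued equilibrium with `k` large coordinates is linearly stable exactly if `k = 1` and
it lies where the exponent increases with the ratio. By strict convexity of the power, two large
coordinates always give a positive eigenvalue and two small ones a negative eigenvalue. -/
theorem isLinearlyStable_iff_of_isTwoValued (hp : HasStarField p) (hα : 1 < α) {k : ℕ} {m r : ℝ}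
    (hk : 0 < k) (hkm : (Fintype.card E : ℝ) - k = m) (hm : 0 < m) (h1 : 1 < r)
    (h2 : r < ((k : ℝ) + 1) / k) (hr : ratioExponent k m r = α) {x : E → ℝ}
    (hx : IsTwoValued k (r / (k * r + m)) (1 / (k * r + m)) x) :
    IsLinearlyStable p α x ↔ k = 1 ∧ 0 < exponentSlope k m r := by
  have hk' : (0 : ℝ) < k := by exact_mod_cast hk
  rw [isLinearlyStable_iff hp hα (isEquilibrium_of_isTwoValued hp hα hk hkm hm h1 h2 hr hx),
    exponentSlope_pos_iff hk' hm h1 h2 hr]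
  have hpa := weight_high_pos hm h1.le
  have hpb := (lt_ratio_bound_iff hk').1 h2
  have hr0 : 0 < r := by linarith
  have hd : 0 < k * r + m := by positivity
  have hN : (Fintype.card E : ℝ) = k + m := by linarith
  rw [ratioExponent_eq_iff hk' hm h1 h2] at hr
  obtain ⟨a, ha⟩ : ∃ a, a = ((m + 1) * r - m) / (k * r + m) := ⟨_, rfl⟩
  obtain ⟨b, hb⟩ : ∃ b, b = (k + 1 - k * r) / (k * r + m) := ⟨_, rfl⟩
  have ha0 : 0 < a := by rw [ha]; positivity
  have hb0 : 0 < b := by rw [hb]; positivity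
  have ha1 : 1 + a = (k + m + 1) * r / (k * r + m) := by rw [ha]; field_simp; ring
  have hb1 : 1 + b = (k + m + 1) / (k * r + m) := by rw [hb]; field_simp; ring
  have hab1 : 1 + a = (1 + b) * r := by rw [ha1, hb1]; ring
  have hab : a = b * r ^ α := by
    rw [← hr, ha, hb, div_mul_div_comm, mul_comm ((k : ℝ) + 1 - k * r),
      mul_div_mul_right _ _ hpb.ne']
  have hsum : k * a + m * b = 1 := by rw [ha, hb]; field_simp; ring
  have hw : IsTwoValued k a b fun i => (Fintype.card E + 1) * x i - 1 := by
    obtain ⟨S, hS, hS1, hS2⟩ := hx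
    refine ⟨S, hS, fun i hi => ?_, fun i hi => ?_⟩
    · simp only [hS1 i hi, hN, ha]; field_simp; ring
    · simp only [hS2 i hi, hN, hb]; field_simp; ring
  have hblock : α * a * b * (m / (1 + a) + k / (1 + b)) - 1 =
      α * (((m + 1) * r - m) * (k + 1 - k * r)) / ((k + m + 1) * r) - 1 := by
    rw [ha1, hb1, ha, hb]
    field_simp
    ring
  rw [← hblock]
  constructor
  · intro h
    refine ⟨?_, ?_⟩
    · by_contra hk1
      obtain ⟨S, hS, hS1, hS2⟩ := hw
      obtain ⟨i, hi, j, hj, hij⟩ := Finset.one_lt_card.1 (by omega : 1 < S.card)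
      have h3 := h _ (isComplexEigenvalue_of_eq hij ((hS1 i hi).trans (hS1 j hj).symm))
      rw [Complex.ofReal_re] at h3
      have hwi : (Fintype.card E + 1) * x i - 1 = a := hS1 i hi
      rw [hwi, neg_add_lt_iff_lt_add, add_zero, div_lt_one (by positivity)] at h3
      -- Bernoulli's inequality for `r⁻¹`: the power lies above its tangent at the larger value
      have h4 := one_add_mul_self_lt_rpow_one_add (s := r⁻¹ - 1)
        (by linarith [inv_pos.2 hr0]) (by linarith [inv_lt_one_of_one_lt₀ h1]) hα
      rw [add_sub_cancel, Real.inv_rpow hr0.le] at h4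
      have h5 := mul_lt_mul_of_pos_left h4 (mul_pos ha0 hr0)
      have h6 : a * r * (1 + α * (r⁻¹ - 1)) = a * (r + α * (1 - r)) := by
        field_simp
      have h7 : a * r * (r ^ α)⁻¹ = b * r := by
        rw [hab]
        field_simp
      rw [h6, h7] at h5
      have h8 := mul_lt_mul_of_pos_right h3 (sub_pos.2 h1)
      linarith
    · have h3 := h _ (isComplexEigenvalue_of_isTwoValued hk hm hkm ha0 hb0 hsum hw)
      rwa [Complex.ofReal_re] at h3
  · rintro ⟨rfl, h⟩ μ hμ
    rw [Nat.cast_one] at *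
    refine re_neg_of_isTwoValued_one hm hkm ha0 hb0 (by linarith) hw ?_ h hμ
    -- Bernoulli's inequality for `r`: the power lies above its tangent at the smaller value
    have h4 := one_add_mul_self_lt_rpow_one_add (s := r - 1) (by linarith) (by linarith) hα
    rw [add_sub_cancel] at h4
    have h5 := mul_lt_mul_of_pos_left h4 hb0
    rw [← hab] at h5
    have h6 : α * b < 1 + b := by
      refine lt_of_mul_lt_mul_right (a := r - 1) ?_ (by linarith)
      linarith
    rw [← div_lt_one (by positivity)] at h6
    linarith

end StabilityOfEquilibria

/-! ### The list of equilibria and their stability -/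

lemma ratio_div_strictMonoOn {k m : ℝ} (hk : 0 < k) (hm : 0 < m) :
    StrictMonoOn (fun r : ℝ => r / (k * r + m)) (Set.Ioi 0) := by
  intro r hr s hs hrs
  have hr' : 0 < r := hr
  have hs' : 0 < s := hs
  change r / (k * r + m) < s / (k * s + m)
  rw [div_lt_div_iff₀ (by positivity) (by positivity)]
  nlinarith

theorem theorem7 (n : ℕ) (hn : 2 ≤ n) :
    ∃ (αt : ℕ → ℝ) (v u v' u' : ℕ → ℝ → ℝ),
      -- the thresholds
      (∀ k : ℕ, 1 ≤ k → k ≤ n → 1 < αt k ∧ αt k < n + 1) ∧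
      -- the list of all equilibria
      (∀ α : ℝ, 1 < α → ∀ x : StarEdge n → ℝ, IsEquilibrium (starLaw n) α x ↔
        x = (fun _ => 1 / (n : ℝ)) ∨
        (∃ k : ℕ, 1 ≤ k ∧ 2 * k < n ∧ αt k ≤ α ∧ IsTwoValued k (v k α) (u k α) x) ∨
        (∃ k : ℕ, 1 ≤ k ∧ 2 * k < n ∧ αt k < α ∧ α < n + 1 ∧
          IsTwoValued k (v' k α) (u' k α) x) ∨
        (∃ k : ℕ, n ≤ 2 * k ∧ k < n ∧ (n : ℝ) + 1 < α ∧ IsTwoValued k (v k α) (u k α) x)) ∧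
      -- the increasing branches for `1 ≤ k < n / 2`
      (∀ k : ℕ, 1 ≤ k → 2 * k < n →
        (∀ α : ℝ, αt k ≤ α → u k α < v k α) ∧ StrictMonoOn (v k) (Set.Ici (αt k))) ∧
      -- the decreasing branches for `1 ≤ k < n / 2`
      (∀ k : ℕ, 1 ≤ k → 2 * k < n →
        (∀ α : ℝ, αt k < α → α < n + 1 → u' k α < v' k α ∧ v' k α < v k α) ∧
        StrictAntiOn (v' k) (Set.Ioo (αt k) (n + 1))) ∧
      -- the increasing branches for `n / 2 ≤ k ≤ n - 1`
      (∀ k : ℕ, n ≤ 2 * k → k < n →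
        (∀ α : ℝ, (n : ℝ) + 1 < α → u k α < v k α) ∧
        StrictMonoOn (v k) (Set.Ioi ((n : ℝ) + 1))) ∧
      -- stability of the uniform vector
      (∀ α : ℝ, 1 < α →
        (IsLinearlyStable (starLaw n) α (fun _ => 1 / (n : ℝ)) ↔ α < n + 1)) ∧
      IsCritical (starLaw n) ((n : ℝ) + 1) (fun _ => 1 / (n : ℝ)) ∧
      -- stability of the increasing branches for `1 ≤ k < n / 2`
      (∀ k : ℕ, 1 ≤ k → 2 * k < n → ∀ α : ℝ, αt k ≤ α → ∀ x : StarEdge n → ℝ,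
        IsTwoValued k (v k α) (u k α) x →
          (IsLinearlyStable (starLaw n) α x ↔ k = 1 ∧ αt 1 < α)) ∧
      -- no stability of the decreasing branches
      (∀ k : ℕ, 1 ≤ k → 2 * k < n → ∀ α : ℝ, αt k < α → α < n + 1 → ∀ x : StarEdge n → ℝ,
        IsTwoValued k (v' k α) (u' k α) x → ¬ IsLinearlyStable (starLaw n) α x) ∧
      -- for `n / 2 ≤ k ≤ n - 1`, only `n = 2` (where `k = 1`) gives stability
      (∀ k : ℕ, n ≤ 2 * k → k < n → ∀ α : ℝ, (n : ℝ) + 1 < α → ∀ x : StarEdge n → ℝ,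
        IsTwoValued k (v k α) (u k α) x → (IsLinearlyStable (starLaw n) α x ↔ n = 2)) ∧
      -- the limit of the stable branch
      Filter.Tendsto (v 1) Filter.atTop (nhds (2 / ((n : ℝ) + 1))) := by
  have hp := hasStarField_starLaw n
  have hcard := card_starEdge n
  have hcardR : (Fintype.card (StarEdge n) : ℝ) = n := by rw [hcard]
  have hE : 1 < Fintype.card (StarEdge n) := by omega
  have : Nonempty (StarEdge n) := Fintype.card_pos_iff.1 (by omega)
  have hnR : (2 : ℝ) ≤ n := by exact_mod_cast hn
  have hm : ∀ k : ℕ, k < n → (0 : ℝ) < n - k := fun k hk => by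
    rw [sub_pos]; exact_mod_cast hk
  have hlow : ∀ k : ℕ, ∃ (A : ℝ) (ρ ρ' : ℝ → ℝ), 0 < k → 2 * k < n → 1 < A ∧ A < n + 1 ∧
      (∀ α, A ≤ α → ρ α ∈ Set.Ioo 1 (((k : ℝ) + 1) / k)) ∧
      (∀ α, A < α → α < n + 1 → 1 < ρ' α ∧ ρ' α < ρ α) ∧
      StrictMonoOn ρ (Set.Ici A) ∧ StrictAntiOn ρ' (Set.Ioo A (n + 1)) ∧
      (∀ r ∈ Set.Ioo 1 (((k : ℝ) + 1) / k), ∀ α, ratioExponent k (n - k) r = α ↔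
        (A ≤ α ∧ r = ρ α) ∨ (A < α ∧ α < n + 1 ∧ r = ρ' α)) ∧
      (∀ α, A ≤ α → (0 < exponentSlope k (n - k) (ρ α) ↔ A < α)) ∧
      (∀ α, A < α → α < n + 1 → exponentSlope k (n - k) (ρ' α) < 0) ∧
      Tendsto ρ atTop (𝓝 (((k : ℝ) + 1) / k)) := by
    intro k
    by_cases hk : 0 < k ∧ 2 * k < n
    · have hkm : (k : ℝ) < n - k := by
        have : (2 * k : ℝ) < n := by exact_mod_cast hk.2
        linarith
      obtain ⟨A, ρ, ρ', h⟩ := exists_branches_of_lt (k := k) (by exact_mod_cast hk.1)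
        (hm k (by omega)) hkm
      rw [add_sub_cancel] at h
      exact ⟨A, ρ, ρ', fun _ _ => h⟩
    · exact ⟨0, id, id, fun h1 h2 => absurd ⟨h1, h2⟩ hk⟩
  have hhigh : ∀ k : ℕ, ∃ ρ : ℝ → ℝ, n ≤ 2 * k → k < n →
      (∀ α, (n : ℝ) + 1 < α → ρ α ∈ Set.Ioo 1 (((k : ℝ) + 1) / k)) ∧
      StrictMonoOn ρ (Set.Ioi (n + 1)) ∧
      (∀ r ∈ Set.Ioo 1 (((k : ℝ) + 1) / k), ∀ α, ratioExponent k (n - k) r = α ↔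
        n + 1 < α ∧ r = ρ α) ∧
      (∀ α, (n : ℝ) + 1 < α → 0 < exponentSlope k (n - k) (ρ α)) ∧
      Tendsto ρ atTop (𝓝 (((k : ℝ) + 1) / k)) := by
    intro k
    by_cases hk : n ≤ 2 * k ∧ k < n
    · have hkm : (n : ℝ) - k ≤ k := by
        have : (n : ℝ) ≤ 2 * k := by exact_mod_cast hk.1
        linarith
      have hk0 : 0 < k := by omega
      obtain ⟨ρ, h⟩ := exists_branch_of_le (k := k) (by exact_mod_cast hk0) (hm k hk.2) hkm
      rw [add_sub_cancel] at h
      exact ⟨ρ, fun _ _ => h⟩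
    · exact ⟨id, fun h1 h2 => absurd ⟨h1, h2⟩ hk⟩
  choose A ρ ρ' hlow using hlow
  choose σ hhigh using hhigh
  -- the ratio on the increasing branch, for small and for large `k`
  set τ : ℕ → ℝ → ℝ := fun k => if 2 * k < n then ρ k else σ k with hτ
  have hτ1 : ∀ k, 2 * k < n → τ k = ρ k := fun k hk => if_pos hk
  have hτ2 : ∀ k, n ≤ 2 * k → τ k = σ k := fun k hk => if_neg (by omega)
  set V : ℕ → ℝ → ℝ := fun k r => r / (k * r + (n - k)) with hV
  set U : ℕ → ℝ → ℝ := fun k r => 1 / (k * r + (n - k)) with hU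
  have hUV : ∀ k : ℕ, k < n → ∀ r : ℝ, 1 < r → U k r < V k r := by
    intro k hk r hr
    have := hm k hk
    have : (0 : ℝ) < k * r + (n - k) := by positivity
    exact div_lt_div_of_pos_right hr this
  have hVmono : ∀ k : ℕ, 0 < k → k < n → StrictMonoOn (V k) (Set.Ioi 0) := fun k hk hkn =>
    ratio_div_strictMonoOn (by exact_mod_cast hk) (hm k hkn)
  have hA : ∀ k, 1 ≤ k → 2 * k < n →
      (if 1 ≤ k ∧ 2 * k < n then A k else 3 / 2) = A k := fun k h1 h2 => if_pos ⟨h1, h2⟩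
  have hchar : ∀ α, 1 < α → ∀ x : StarEdge n → ℝ, IsEquilibrium (starLaw n) α x ↔
      x = (fun _ => 1 / (n : ℝ)) ∨ ∃ k : ℕ, 0 < k ∧ k < n ∧
        ∃ r ∈ Set.Ioo 1 (((k : ℝ) + 1) / k), ratioExponent k (n - k) r = α ∧
          IsTwoValued k (V k r) (U k r) x := by
    intro α hα x
    have := isEquilibrium_iff hp hα x
    rwa [hcard] at this
  have hstab : ∀ k : ℕ, 0 < k → k < n → ∀ r ∈ Set.Ioo 1 (((k : ℝ) + 1) / k), ∀ α, 1 < α →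
      ratioExponent k (n - k) r = α → ∀ x : StarEdge n → ℝ, IsTwoValued k (V k r) (U k r) x →
      (IsLinearlyStable (starLaw n) α x ↔ k = 1 ∧ 0 < exponentSlope k (n - k) r) :=
    fun k hk hkn r hr α hα hrα x hx => isLinearlyStable_iff_of_isTwoValued hp hα hk
      (by rw [hcardR]) (hm k hkn) hr.1 hr.2 hrα hx
  -- for `n ≤ 2 * k` there is no turning point, and the threshold may be any number in `(1, n + 1)`
  refine ⟨fun k => if 1 ≤ k ∧ 2 * k < n then A k else 3 / 2, fun k α => V k (τ k α),
    fun k α => U k (τ k α), fun k α => V k (ρ' k α), fun k α => U k (ρ' k α),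
    ?_, ?_, ?_, ?_, ?_, ?_, ?_, ?_, ?_, ?_, ?_⟩
  · intro k hk1 _
    by_cases hk : 2 * k < n
    · simp only [hA k hk1 hk]
      exact ⟨(hlow k hk1 hk).1, (hlow k hk1 hk).2.1⟩
    · simp only [if_neg (fun h : 1 ≤ k ∧ 2 * k < n => hk h.2)]
      constructor <;> linarith
  · intro α hα x
    rw [hchar α hα x]
    refine or_congr_right ⟨?_, ?_⟩
    · rintro ⟨k, hk, hkn, r, hr, hrα, hx⟩
      rcases lt_or_ge (2 * k) n with h | h
      · obtain ⟨-, -, -, -, -, -, hsol, -⟩ := hlow k hk h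
        rcases (hsol r hr α).1 hrα with ⟨h1, rfl⟩ | ⟨h1, h2, rfl⟩
        · exact Or.inl ⟨k, hk, h, by simpa only [hA k hk h], by simpa only [hτ1 k h]⟩
        · exact Or.inr (Or.inl ⟨k, hk, h, by simpa only [hA k hk h], h2, hx⟩)
      · obtain ⟨-, -, hsol, -⟩ := hhigh k h hkn
        obtain ⟨h1, rfl⟩ := (hsol r hr α).1 hrα
        exact Or.inr (Or.inr ⟨k, h, hkn, h1, by simpa only [hτ2 k h]⟩)
    · rintro (⟨k, hk, h, h1, hx⟩ | ⟨k, hk, h, h1, h2, hx⟩ | ⟨k, h, hkn, h1, hx⟩)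
      · simp only [hτ1 k h, hA k hk h] at hx h1
        obtain ⟨-, -, hmem, -, -, -, hsol, -⟩ := hlow k hk h
        exact ⟨k, hk, by omega, _, hmem α h1, (hsol _ (hmem α h1) α).2 (Or.inl ⟨h1, rfl⟩), hx⟩
      · simp only [hA k hk h] at h1
        obtain ⟨-, -, hmem, hmem', -, -, hsol, -⟩ := hlow k hk h
        have hr := hmem' α h1 h2
        have hr' : ρ' k α ∈ Set.Ioo 1 (((k : ℝ) + 1) / k) :=
          ⟨hr.1, hr.2.trans (hmem α h1.le).2⟩
        exact ⟨k, hk, by omega, _, hr', (hsol _ hr' α).2 (Or.inr ⟨h1, h2, rfl⟩), hx⟩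
      · simp only [hτ2 k h] at hx
        obtain ⟨hmem, -, hsol, -⟩ := hhigh k h hkn
        exact ⟨k, by omega, hkn, _, hmem α h1, (hsol _ (hmem α h1) α).2 ⟨h1, rfl⟩, hx⟩
  · intro k hk h
    simp only [hA k hk h, hτ1 k h]
    obtain ⟨-, -, hmem, -, hmono, -⟩ := hlow k hk h
    refine ⟨fun α hα => hUV k (by omega) _ (hmem α hα).1, fun α hα β hβ hαβ => ?_⟩
    exact hVmono k hk (by omega) (zero_lt_one.trans (hmem α hα).1)
      (zero_lt_one.trans (hmem β hβ).1) (hmono hα hβ hαβ)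
  · intro k hk h
    simp only [hA k hk h, hτ1 k h]
    obtain ⟨-, -, hmem, hmem', -, hanti, -⟩ := hlow k hk h
    refine ⟨fun α h1 h2 => ⟨hUV k (by omega) _ (hmem' α h1 h2).1, ?_⟩, fun α hα β hβ hαβ => ?_⟩
    · exact hVmono k hk (by omega) (zero_lt_one.trans (hmem' α h1 h2).1)
        (zero_lt_one.trans (hmem α h1.le).1) (hmem' α h1 h2).2
    · exact hVmono k hk (by omega) (zero_lt_one.trans (hmem' β hβ.1 hβ.2).1)
        (zero_lt_one.trans (hmem' α hα.1 hα.2).1) (hanti hα hβ hαβ)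
  · intro k h hkn
    simp only [hτ2 k h]
    obtain ⟨hmem, hmono, -⟩ := hhigh k h hkn
    refine ⟨fun α hα => hUV k hkn _ (hmem α hα).1, fun α hα β hβ hαβ => ?_⟩
    exact hVmono k (by omega) hkn (zero_lt_one.trans (hmem α hα).1)
      (zero_lt_one.trans (hmem β hβ).1) (hmono hα hβ hαβ)
  · intro α hα
    have := isLinearlyStable_uniform_iff hp hα hE
    rwa [hcard] at this
  · have := isCritical_uniform hp hE
    rwa [hcard] at this
  · intro k hk h α hα x hx
    simp only [hA k hk h, hτ1 k h] at hα hx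
    obtain ⟨h1A, -, hmem, -, -, -, hsol, hslope, -⟩ := hlow k hk h
    rw [hstab k hk (by omega) _ (hmem α hα) α (h1A.trans_le hα)
      ((hsol _ (hmem α hα) α).2 (Or.inl ⟨hα, rfl⟩)) x hx, hslope α hα]
    refine and_congr_right fun hk1 => ?_
    subst hk1
    simp only [hA 1 hk h]
  · intro k hk h α h1 h2 x hx
    simp only [hA k hk h] at h1
    obtain ⟨h1A, -, hmem, hmem', -, -, hsol, -, hslope, -⟩ := hlow k hk h
    have hr := hmem' α h1 h2
    have hr' : ρ' k α ∈ Set.Ioo 1 (((k : ℝ) + 1) / k) := ⟨hr.1, hr.2.trans (hmem α h1.le).2⟩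
    rw [hstab k hk (by omega) _ hr' α (h1A.trans h1)
      ((hsol _ hr' α).2 (Or.inr ⟨h1, h2, rfl⟩)) x hx]
    exact fun h3 => (hslope α h1 h2).not_gt h3.2
  · intro k h hkn α hα x hx
    simp only [hτ2 k h] at hx
    obtain ⟨hmem, -, hsol, hslope, -⟩ := hhigh k h hkn
    rw [hstab k (by omega) hkn _ (hmem α hα) α (by linarith)
      ((hsol _ (hmem α hα) α).2 ⟨hα, rfl⟩) x hx, and_iff_left (hslope α hα)]
    omega
  · have hτlim : Tendsto (τ 1) atTop (𝓝 2) := by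
      have e : (((1 : ℕ) : ℝ) + 1) / ((1 : ℕ) : ℝ) = 2 := by norm_num
      rcases lt_or_ge (2 * 1) n with h | h
      · have := (hlow 1 one_pos h).2.2.2.2.2.2.2.2.2
        rwa [hτ1 1 h, ← e]
      · have := (hhigh 1 h (by omega)).2.2.2.2
        rwa [hτ2 1 h, ← e]
    have hc : ContinuousAt (V 1) 2 := by
      have : ((1 : ℕ) : ℝ) * 2 + (n - (1 : ℕ)) ≠ 0 := by
        push_cast
        linarith
      exact continuousAt_id.div (by fun_prop) this
    have := hc.tendsto.comp hτlim
    have e : V 1 2 = 2 / ((n : ℝ) + 1) := by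
      simp only [hV, Nat.cast_one]
      congr 1
      ring
    rwa [e] at this
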